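/- **Theorem 4.1 (Bolthausen–Kistler model).** Let $n\ge 1$, $I=\{1,\dots,n\}$, and let $S$ be the collection of nonempty subsets of $I$. For every $N\ge n$ let $k(1,N),\dots,k(n,N)$ be non-negative integers with $\sum_j k(j,N)=N$, and suppose $k(j,N)/N\to p_j>0$ for every $j$. Write $\sigma\in\{+1,-1\}^N$ as $\sigma=\sigma_1\cdots\sigma_n$ with $\sigma_j\in\{+1,-1\}^{k(j,N)}$, and $\sigma(s)=(\sigma_j)_{j\in s}$ for $s\in S$. For each $s\in S$ let $(\lambda_N^s)_N$ be probability measures on $\mathbb R$ that converge weakly to $\delta_0$ and satisfy the large deviation principle (LDP) with speed $N$ and a convex rate function $\mathcal I_s:\mathbb R\to[0,\infty]$. On one probability space let, for every $N\ge n$, the random variables $\xi_N(s,\tau)$ ($s\in S$, $\tau\in\prod_{j\in s}\{+1,-1\}^{k(j,N)}$) be independent, $\xi_N(s,\tau)$ having law $\lambda_N^s$; nothing is assumed on the joint law for different $N$. Define the random empirical measures on $\mathbb R^S$ $$\mu_N(\omega)=\frac1{2^N}\sum_{\sigma}\delta_{(\xi_N(s,\sigma(s))(\omega))_{s\in S}},$$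 and put $$\mathrm{Supp}(\mathcal J)=\Big\{x\in\mathbb R^S:\ \sum_{\emptyset\ne t\subseteq s}\mathcal I_t(x_t)\le\sum_{k\in s}p_k\log 2\ \text{ for all } s\in S\Big\},$$ $$\mathcal J(x)=\sum_{s\in S}\mathcal I_s(x_s)\ \text{ if } x\in\mathrm{Supp}(\mathcal J),\qquad \mathcal J(x)=\infty\ \text{ otherwise.}$$ Then: 1. For a.e. $\omega$ the sequence $(\mu_N(\omega))$ satisfies the weak LDP with speed $N$ and rate function $\mathcal J$. 2. If $n=1$, or if $\mathrm{Supp}(\mathcal J)$ is compact (for instance, if every $\mathcal I_s$ has compact level sets), then for a.e. $\omega$ the sequence $(\mu_N(\omega))$ satisfies the LDP with speed $N$ and rate function $\mathcal J$. Here a rate function is a lower semicontinuous function with values in $[0,\infty]$; the LDP for $(\mu_N)$ with rate function $\mathcal J$ means $\liminf_N\frac1N\log\mu_N(G)\ge-\inf_G\mathcal J$ for all open $G$ and $\limsup_N\frac1N\log\mu_N(F)\le-\inf_F\mathcal J$ for all closed $F$; in the weak LDP the upper bound is required for compact sets only. -/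

import Mathlib

open MeasureTheory ProbabilityTheory Filter Topology Set
open scoped ENNReal NNReal

noncomputable section

namespace BKM

/-! ### Large deviation principles -/

/-- A rate function on `X`: a lower semicontinuous function with values in `[0, ∞]`. -/
def IsRateFunction {X : Type*} [TopologicalSpace X] (I : X → ℝ≥0∞) : Prop :=
  LowerSemicontinuous I

/-- The exponential rate `(1 / N) log (μ_N A)`, an extended real (`log 0 = -∞`). -/
def logRate {X : Type*} [MeasurableSpace X] (μ : ℕ → Measure X) (A : Set X) (N : ℕ) : EReal :=
  ENNReal.log (μ N A) / ((N : ℝ) : EReal)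

/-- `inf_{x ∈ A} I x`, as an extended real (`+∞` for empty `A`). -/
def infRate {X : Type*} (I : X → ℝ≥0∞) (A : Set X) : EReal :=
  ((⨅ x ∈ A, I x : ℝ≥0∞) : EReal)

/-- The (full) large deviation principle with speed `N`: lower bound for open sets and
upper bound for closed sets. -/
structure SatisfiesLDP {X : Type*} [TopologicalSpace X] [MeasurableSpace X]
    (μ : ℕ → Measure X) (I : X → ℝ≥0∞) : Prop where
  rate : IsRateFunction I
  lower : ∀ G : Set X, IsOpen G → -infRate I G ≤ liminf (logRate μ G) atTop
  upper : ∀ F : Set X, IsClosed F → limsup (logRate μ F) atTop ≤ -infRate I F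

/-- The weak large deviation principle with speed `N`: lower bound for open sets and
upper bound for compact sets. -/
structure SatisfiesWeakLDP {X : Type*} [TopologicalSpace X] [MeasurableSpace X]
    (μ : ℕ → Measure X) (I : X → ℝ≥0∞) : Prop where
  rate : IsRateFunction I
  lower : ∀ G : Set X, IsOpen G → -infRate I G ≤ liminf (logRate μ G) atTop
  upper : ∀ K : Set X, IsCompact K → limsup (logRate μ K) atTop ≤ -infRate I K

/-! ### The model -/

/-- The collection `S` of nonempty subsets of the `n`-element index set. -/
abbrev Subsets (n : ℕ) : Type := {s : Finset (Fin n) // s.Nonempty}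

/-- `{+1, -1}^m`. -/
abbrev Spins (m : ℕ) : Type := Fin m → ℤˣ

/-- The configurations `σ = σ₁ σ₂ ⋯ σₙ` with `σ_j ∈ {+1, -1}^(k j)`. -/
abbrev Config {n : ℕ} (k : Fin n → ℕ) : Type := (j : Fin n) → Spins (k j)

/-- The configurations `σ(s) = (σ_j)_{j ∈ s}` over the blocks in `s`. -/
abbrev SubConfig {n : ℕ} (k : Fin n → ℕ) (s : Finset (Fin n)) : Type :=
  (j : s) → Spins (k j)

/-- The restriction `σ ↦ σ(s)`. -/
def Config.restrict {n : ℕ} {k : Fin n → ℕ} (σ : Config k) (s : Finset (Fin n)) :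
    SubConfig k s :=
  fun j => σ j

/-- The empirical measure `2^{-N} ∑_σ δ⟨ξ(s, σ(s)) : s ∈ S⟩` on `ℝ^S`, for given values
`ξ(s, τ)` of the variables. -/
def empiricalMeasure {n : ℕ} (N : ℕ) (k : Fin n → ℕ)
    (ξ : (s : Subsets n) → SubConfig k s.1 → ℝ) : Measure (Subsets n → ℝ) :=
  ((2 : ℝ≥0∞) ^ N)⁻¹ •
    ∑ σ : Config k, Measure.dirac (fun s : Subsets n => ξ s (σ.restrict s.1))

/-- The set `Supp(J)` of all `x` with `∑_{t ⊆ s} I_t(x_t) ≤ ∑_{k ∈ s} p_k log 2` for every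
nonempty `s`, the first sum being over nonempty `t`. -/
def rateSupport {n : ℕ} (p : Fin n → ℝ) (I : Subsets n → ℝ → ℝ≥0∞) : Set (Subsets n → ℝ) :=
  {x | ∀ s : Subsets n,
    ∑ t ∈ Finset.univ.filter (fun t : Subsets n => t.1 ⊆ s.1), I t (x t)
      ≤ ENNReal.ofReal (∑ j ∈ s.1, p j * Real.log 2)}

open Classical in
/-- The rate function `J`: `∑_s I_s(x_s)` on `Supp(J)` and `∞` elsewhere. -/
def rateJ {n : ℕ} (p : Fin n → ℝ) (I : Subsets n → ℝ → ℝ≥0∞) (x : Subsets n → ℝ) : ℝ≥0∞ :=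
  if x ∈ rateSupport p I then ∑ s : Subsets n, I s (x s) else ∞

end BKM

end

/-! The blocks in `s` carry about exp(N ∑_{j ∈ s} p_j log 2) partial configurations, and a small box
around `x` is hit by ξ(t, ·) with probability about exp(-N I_t(x_t)). Everything is a comparison of
this entropy with this cost, made almost sure by Borel–Cantelli.

Upper bound: the mean mass of a box is the product of its side probabilities, so Markov's inequality
gives the rate ∑ I_t(x_t) (`ae_eventually_empiricalMeasure_le`). If the cost over the subsets of
some `s` exceeds the entropy of `s`, a union bound over the partial configurations on `s` shows that
the box is eventually empty (`ae_eventually_notMem_hitEvent`); hence the value ∞ off the support.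

Lower bound: a second moment. Two configurations that share no block hit the box independently.
Those agreeing exactly on the blocks of `A` form at most a fraction 2^(-∑_{j ∈ A} k_j) of all pairs
and gain at most the inverse probability of the sides `s ⊆ A`. The relative variance is thus a sum
over nonempty `A` of exp(-N (entropy - cost)), summable when every constraint is strict
(`ae_eventually_le_empiricalMeasure`). Strictness comes from moving `x` slightly towards 0: weak
convergence to δ_0 forces I_s(0) = 0, and convexity makes the costs shrink
(`exists_mem_strict_of_rateJ_lt`). Countably many rational boxes and rates then suffice for the weak
principle.

Full principle: in each direction, either I_s passes the entropy of `s`, and then no variable gets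
that far, or I_s is bounded there and hence zero by convexity. The second case contradicts
compactness of the support; for n = 1 it makes the rate function vanish, so a closed set meeting
that region has a trivial upper bound. -/

namespace BKM

/-! ### Exponential rates, local criteria and Borel–Cantelli -/

lemma infRate_le {X : Type*} {I : X → ℝ≥0∞} {A : Set X} {x : X} (hx : x ∈ A) :
    infRate I A ≤ (I x : EReal) := by
  unfold infRate
  exact_mod_cast iInf₂_le x hx

lemma coe_lt_infRate_of_forall {X : Type*} {I : X → ℝ≥0∞} {A : Set X} {r : ℝ} {c : ℝ≥0∞}
    (hr : (r : EReal) < c) (h : ∀ x ∈ A, c ≤ I x) : (r : EReal) < infRate I A := by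
  refine hr.trans_le ?_
  unfold infRate
  exact_mod_cast le_iInf₂ h

section Rates

variable {X : Type*} [MeasurableSpace X] {μ : ℕ → Measure X}

lemma ofReal_exp_eq (r : ℝ) : ENNReal.ofReal (Real.exp r) = EReal.exp (r : EReal) := by
  simp

lemma coe_le_logRate_iff {A : Set X} {N : ℕ} (hN : 0 < N) (r : ℝ) :
    (r : EReal) ≤ logRate μ A N ↔ ENNReal.ofReal (Real.exp (N * r)) ≤ μ N A := by
  have h0 : (0 : EReal) < ((N : ℝ) : EReal) := by exact_mod_cast hN
  rw [logRate, EReal.le_div_iff_mul_le h0 (EReal.coe_ne_top _), ofReal_exp_eq,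
    ← ENNReal.logOrderIso_apply, ← OrderIso.symm_apply_le, mul_comm]
  rw [EReal.coe_mul]; rfl

lemma logRate_le_coe_iff {A : Set X} {N : ℕ} (hN : 0 < N) (r : ℝ) :
    logRate μ A N ≤ (r : EReal) ↔ μ N A ≤ ENNReal.ofReal (Real.exp (N * r)) := by
  have h0 : (0 : EReal) < ((N : ℝ) : EReal) := by exact_mod_cast hN
  rw [logRate, EReal.div_le_iff_le_mul h0 (EReal.coe_ne_top _), ofReal_exp_eq,
    ← ENNReal.logOrderIso_apply, ← OrderIso.le_symm_apply]
  rw [EReal.coe_mul]; rfl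

lemma le_liminf_logRate {A : Set X} {r : ℝ}
    (h : ∀ᶠ N : ℕ in atTop, ENNReal.ofReal (Real.exp (-(N * r))) ≤ μ N A) :
    -(r : EReal) ≤ liminf (logRate μ A) atTop := by
  refine le_liminf_of_le (by isBoundedDefault) ?_
  filter_upwards [h, eventually_gt_atTop 0] with N hN h0
  rw [← EReal.coe_neg, coe_le_logRate_iff h0]
  simpa using hN

lemma limsup_logRate_le {A : Set X} {r : ℝ}
    (h : ∀ᶠ N : ℕ in atTop, μ N A ≤ ENNReal.ofReal (Real.exp (-(N * r)))) :
    limsup (logRate μ A) atTop ≤ -(r : EReal) := by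
  refine limsup_le_of_le (by isBoundedDefault) ?_
  filter_upwards [h, eventually_gt_atTop 0] with N hN h0
  rw [← EReal.coe_neg, logRate_le_coe_iff h0]
  simpa using hN

lemma neg_infRate_le_liminf_of_local {I : X → ℝ≥0∞} {G : Set X}
    (h : ∀ x ∈ G, ∀ r : ℝ, (I x : EReal) < r →
      ∀ᶠ N : ℕ in atTop, ENNReal.ofReal (Real.exp (-(N * r))) ≤ μ N G) :
    -infRate I G ≤ liminf (logRate μ G) atTop := by
  rw [EReal.neg_le]
  refine EReal.le_of_forall_lt_iff_le.1 fun r hr => ?_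
  have : ∃ x ∈ G, (I x : EReal) < r := by
    by_contra! hcon
    refine hr.not_ge ?_
    have h1 : (r : EReal).toENNReal ≤ ⨅ x ∈ G, I x := le_iInf₂ fun x hx => by
      simpa using EReal.toENNReal_le_toENNReal (hcon x hx)
    refine le_trans ?_ (EReal.coe_ennreal_le_coe_ennreal_iff.2 h1)
    rw [EReal.coe_toENNReal_eq_max]
    exact le_max_right _ _
  obtain ⟨x, hx, hxr⟩ := this
  rw [EReal.neg_le]
  exact le_liminf_logRate (h x hx r hxr)

variable [TopologicalSpace X] {I : X → ℝ≥0∞}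

lemma SatisfiesLDP.eventually_le (h : SatisfiesLDP μ I) {F : Set X} (hF : IsClosed F) {r : ℝ}
    (hr : (r : EReal) < infRate I F) :
    ∀ᶠ N : ℕ in atTop, μ N F ≤ ENNReal.ofReal (Real.exp (-(N * r))) := by
  have h1 : limsup (logRate μ F) atTop < ((-r : ℝ) : EReal) := by
    refine (h.upper F hF).trans_lt ?_
    rw [EReal.coe_neg]
    exact EReal.neg_lt_neg_iff.2 hr
  filter_upwards [eventually_lt_of_limsup_lt h1 (by isBoundedDefault), eventually_gt_atTop 0]
    with N hN h0
  simpa using (logRate_le_coe_iff h0 _).1 hN.le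

lemma SatisfiesLDP.eventually_ge (h : SatisfiesLDP μ I) {G : Set X} (hG : IsOpen G) {x : X}
    (hx : x ∈ G) {r : ℝ} (hr : (I x : EReal) < r) :
    ∀ᶠ N : ℕ in atTop, ENNReal.ofReal (Real.exp (-(N * r))) ≤ μ N G := by
  have h1 : ((-r : ℝ) : EReal) < liminf (logRate μ G) atTop := by
    refine lt_of_lt_of_le ?_ (h.lower G hG)
    rw [EReal.coe_neg]
    exact EReal.neg_lt_neg_iff.2 ((infRate_le hx).trans_lt hr)
  filter_upwards [eventually_lt_of_lt_liminf h1 (by isBoundedDefault), eventually_gt_atTop 0]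
    with N hN h0
  simpa using (coe_le_logRate_iff h0 _).1 hN.le

/-- Constant factors are invisible on the exponential scale. -/
lemma eventually_mul_exp_le (m : ℕ) {r r' : ℝ} (h : r < r') :
    ∀ᶠ N : ℕ in atTop, (m : ℝ) * Real.exp (-(N * r')) ≤ Real.exp (-(N * r)) := by
  have h1 : Tendsto (fun N : ℕ => (N : ℝ) * (r' - r)) atTop atTop :=
    tendsto_natCast_atTop_atTop.atTop_mul_const (sub_pos.2 h)
  filter_upwards [(Real.tendsto_exp_atTop.comp h1).eventually_ge_atTop (m : ℝ)] with N hN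
  calc (m : ℝ) * Real.exp (-(N * r')) ≤ Real.exp (N * (r' - r)) * Real.exp (-(N * r')) := by
        gcongr; exact hN
    _ = Real.exp (-(N * r)) := by rw [← Real.exp_add]; ring_nf

/-- Finitely many of the neighbourhoods cover `K`; their number `m` is absorbed by giving up a
little of the rate, from `r'` to `r`. -/
lemma limsup_le_neg_infRate_of_local {K : Set X} (hK : IsCompact K)
    (h : ∀ x, ∀ r : ℝ, (r : EReal) < I x → ∃ U ∈ 𝓝 x,
      ∀ᶠ N : ℕ in atTop, μ N U ≤ ENNReal.ofReal (Real.exp (-(N * r)))) :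
    limsup (logRate μ K) atTop ≤ -infRate I K := by
  rw [EReal.le_neg]
  refine EReal.ge_of_forall_gt_iff_ge.1 fun r hr => ?_
  rw [EReal.le_neg]
  obtain ⟨r', hrr, hr'⟩ := EReal.lt_iff_exists_real_btwn.1 hr
  have hm : ∃ m : ℕ, ∀ᶠ N : ℕ in atTop, μ N K ≤ m * ENNReal.ofReal (Real.exp (-(N * r'))) := by
    refine hK.induction_on (p := fun S => ∃ m : ℕ, ∀ᶠ N : ℕ in atTop,
      μ N S ≤ m * ENNReal.ofReal (Real.exp (-(N * r')))) ⟨0, by simp⟩ ?_ ?_ ?_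
    · rintro S S' hS ⟨m, hm⟩
      exact ⟨m, hm.mono fun N hN => (measure_mono hS).trans hN⟩
    · rintro S S' ⟨m, hm⟩ ⟨m', hm'⟩
      refine ⟨m + m', ?_⟩
      filter_upwards [hm, hm'] with N h1 h2
      refine (measure_union_le _ _).trans ((add_le_add h1 h2).trans_eq ?_)
      push_cast; ring
    · intro x hx
      obtain ⟨U, hU, hN⟩ := h x r' (hr'.trans_le (infRate_le hx))
      exact ⟨U, mem_nhdsWithin_of_mem_nhds hU, 1, by simpa using hN⟩
  obtain ⟨m, hm⟩ := hm
  refine limsup_logRate_le ?_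
  filter_upwards [hm, eventually_mul_exp_le m (EReal.coe_lt_coe_iff.1 hrr)] with N h1 h2
  refine h1.trans ?_
  rw [← ENNReal.ofReal_natCast, ← ENNReal.ofReal_mul (by positivity)]
  exact ENNReal.ofReal_le_ofReal h2

end Rates

/-- Borel–Cantelli with a bound that is only required eventually. -/
lemma ae_eventually_not_of_summable {Ω : Type*} [MeasurableSpace Ω] {P : Measure Ω}
    [IsFiniteMeasure P] {bad : ℕ → Ω → Prop} {f : ℕ → ℝ} (hf : Summable f)
    (h : ∀ᶠ N in atTop, P {ω | bad N ω} ≤ ENNReal.ofReal (f N)) :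
    ∀ᵐ ω ∂P, ∀ᶠ N in atTop, ¬ bad N ω := by
  obtain ⟨N₀, hN₀⟩ := eventually_atTop.1 h
  have h1 : ∑' N, P {ω | bad (N + N₀) ω} ≠ ∞ := by
    have h2 : Summable fun N => f (N + N₀) := (summable_nat_add_iff N₀).2 hf
    refine ne_top_of_le_ne_top ?_ (ENNReal.tsum_le_tsum fun N => hN₀ (N + N₀) (by omega))
    exact h2.tsum_ofReal_ne_top
  filter_upwards [ae_eventually_notMem h1] with ω hω
  obtain ⟨N₁, hN₁⟩ := eventually_atTop.1 hω
  refine eventually_atTop.2 ⟨N₁ + N₀, fun N hN => ?_⟩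
  have := hN₁ (N - N₀) (by omega)
  rwa [Nat.sub_add_cancel (by omega)] at this

lemma summable_of_eventually_le_exp {f : ℕ → ℝ} (hf : ∀ N, 0 ≤ f N) {c : ℝ} (hc : 0 < c)
    (h : ∀ᶠ N : ℕ in atTop, f N ≤ Real.exp (-(N * c))) : Summable f := by
  have h1 : Summable fun N : ℕ => Real.exp (N * (-c)) :=
    Real.summable_exp_nat_mul_iff.2 (by linarith)
  refine h1.of_norm_bounded_eventually_nat ?_
  filter_upwards [h] with N hN
  rw [Real.norm_of_nonneg (hf N)]
  simpa using hN

end BKM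

/-! ### First and second moments at fixed size -/

namespace BKM

variable {Ω : Type*} [MeasurableSpace Ω] {P : Measure Ω} {n : ℕ} {k : Fin n → ℕ}
  {ν : Subsets n → ProbabilityMeasure ℝ} {ξ : (s : Subsets n) → SubConfig k s.1 → Ω → ℝ}

/-- The variables `ξ(s, τ)` are independent and `ξ(s, τ)` has law `ν s`. -/
structure IsDisorder (P : Measure Ω) (k : Fin n → ℕ) (ν : Subsets n → ProbabilityMeasure ℝ)
    (ξ : (s : Subsets n) → SubConfig k s.1 → Ω → ℝ) : Prop where
  measurable : ∀ s τ, Measurable (ξ s τ)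
  map_eq : ∀ s τ, P.map (ξ s τ) = (ν s : Measure ℝ)
  indep : iIndepFun (fun (a : (s : Subsets n) × SubConfig k s.1) => ξ a.1 a.2) P

/-- The event that `ξ(t, σ(t)) ∈ D t` for all `t ∈ T`. -/
def hitEvent (ξ : (s : Subsets n) → SubConfig k s.1 → Ω → ℝ) (D : Subsets n → Set ℝ)
    (T : Finset (Subsets n)) (σ : Config k) : Set Ω :=
  {ω | ∀ t ∈ T, ξ t (σ.restrict t.1) ω ∈ D t}

lemma hitEvent_anti {Ω : Type*} {ξ : (s : Subsets n) → SubConfig k s.1 → Ω → ℝ}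
    {D : Subsets n → Set ℝ} {T T' : Finset (Subsets n)} (h : T ⊆ T') (σ : Config k) :
    hitEvent ξ D T' σ ⊆ hitEvent ξ D T σ :=
  fun _ hω t ht => hω t (h ht)

/-- Indexing by a finite set of pairs (s, τ) counts each variable once, even when several
configurations share it. -/
lemma IsDisorder.measure_forall_mem (h : IsDisorder P k ν ξ) {D : Subsets n → Set ℝ}
    (hD : ∀ s, MeasurableSet (D s)) (T : Finset ((s : Subsets n) × SubConfig k s.1)) :
    P {ω | ∀ a ∈ T, ξ a.1 a.2 ω ∈ D a.1} = ∏ a ∈ T, (ν a.1 : Measure ℝ) (D a.1) := by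
  have h1 := h.indep.measure_inter_preimage_eq_mul T (sets := fun a => D a.1) fun a _ => hD a.1
  have h2 : {ω | ∀ a ∈ T, ξ a.1 a.2 ω ∈ D a.1} = ⋂ a ∈ T, ξ a.1 a.2 ⁻¹' D a.1 := by
    ext ω; simp
  rw [h2, h1]
  refine Finset.prod_congr rfl fun a _ => ?_
  rw [← h.map_eq a.1 a.2, Measure.map_apply (h.measurable _ _) (hD _)]

lemma IsDisorder.measurableSet_hitEvent (h : IsDisorder P k ν ξ) {D : Subsets n → Set ℝ}
    (hD : ∀ s, MeasurableSet (D s)) (T : Finset (Subsets n)) (σ : Config k) :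
    MeasurableSet (hitEvent ξ D T σ) := by
  have : hitEvent ξ D T σ = ⋂ t ∈ T, ξ t (σ.restrict t.1) ⁻¹' D t := by
    ext ω; simp [hitEvent]
  rw [this]
  exact T.measurableSet_biInter fun t _ => h.measurable _ _ (hD t)

lemma IsDisorder.measure_hitEvent (h : IsDisorder P k ν ξ) {D : Subsets n → Set ℝ}
    (hD : ∀ s, MeasurableSet (D s)) (T : Finset (Subsets n)) (σ : Config k) :
    P (hitEvent ξ D T σ) = ∏ t ∈ T, (ν t : Measure ℝ) (D t) := by
  have h1 := h.measure_forall_mem hD (T.sigma fun t => {σ.restrict t.1})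
  rw [Finset.prod_sigma] at h1
  refine Eq.trans (congrArg P ?_) (h1.trans (by simp))
  ext ω
  simp only [hitEvent, mem_ofPred_eq, Sigma.forall, Finset.mem_sigma, Finset.mem_singleton]
  constructor
  · rintro ha t τ ⟨ht, rfl⟩
    exact ha t ht
  · exact fun ha t ht => ha t _ ⟨ht, rfl⟩

open Classical in
lemma IsDisorder.measure_hitEvent_inter (h : IsDisorder P k ν ξ) {D : Subsets n → Set ℝ}
    (hD : ∀ s, MeasurableSet (D s)) (T : Finset (Subsets n)) (σ σ' : Config k) :
    P (hitEvent ξ D T σ ∩ hitEvent ξ D T σ') =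
      ∏ t ∈ T, (ν t : Measure ℝ) (D t) ^
        (if σ.restrict t.1 = σ'.restrict t.1 then 1 else 2) := by
  have h1 := h.measure_forall_mem hD
    (T.sigma fun t => {σ.restrict t.1, σ'.restrict t.1})
  rw [Finset.prod_sigma] at h1
  have h2 : hitEvent ξ D T σ ∩ hitEvent ξ D T σ' =
      {ω | ∀ a ∈ T.sigma fun t => {σ.restrict t.1, σ'.restrict t.1},
        ξ a.1 a.2 ω ∈ D a.1} := by
    ext ω
    simp only [hitEvent, mem_inter_iff, mem_ofPred_eq, Sigma.forall, Finset.mem_sigma,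
      Finset.mem_insert, Finset.mem_singleton]
    constructor
    · rintro ⟨ha, hb⟩ t τ ⟨ht, rfl | rfl⟩
      exacts [ha t ht, hb t ht]
    · intro ha
      exact ⟨fun t ht => ha t _ ⟨ht, Or.inl rfl⟩, fun t ht => ha t _ ⟨ht, Or.inr rfl⟩⟩
  rw [h2, h1]
  refine Finset.prod_congr rfl fun t _ => ?_
  split_ifs with heq
  · simp [heq]
  · rw [Finset.prod_pair heq, sq]

/-- The extension of a partial configuration by `+1`. -/
def SubConfig.extend {s : Finset (Fin n)} (τ : SubConfig k s) : Config k :=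
  fun j => if hj : j ∈ s then τ ⟨j, hj⟩ else 1

lemma restrict_extend_restrict {s t : Finset (Fin n)} (hts : t ⊆ s) (σ : Config k) :
    (SubConfig.extend (σ.restrict s)).restrict t = σ.restrict t := by
  funext j
  simp [SubConfig.extend, Config.restrict, hts j.2]

lemma card_subConfig (s : Finset (Fin n)) :
    Fintype.card (SubConfig k s) = 2 ^ ∑ j ∈ s, k j := by
  rw [Fintype.card_pi]
  simp only [Fintype.card_pi, Fintype.card_units_int, Finset.prod_const, Finset.card_univ,
    Fintype.card_fin]
  rw [Finset.prod_coe_sort s (fun j => 2 ^ k j), Finset.prod_pow_eq_pow_sum]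

lemma card_config : Fintype.card (Config k) = 2 ^ ∑ j, k j := by
  rw [Fintype.card_pi]
  simp [Finset.prod_pow_eq_pow_sum]

/-- The event depends on σ only through σ(s), so the union bound needs one representative per
partial configuration on `s`. -/
lemma IsDisorder.measure_exists_le (h : IsDisorder P k ν ξ) {D : Subsets n → Set ℝ}
    (hD : ∀ s, MeasurableSet (D s)) (s : Finset (Fin n)) {T : Finset (Subsets n)}
    (hT : ∀ t ∈ T, t.1 ⊆ s) :
    P {ω | ∃ σ, ω ∈ hitEvent ξ D T σ} ≤
      2 ^ (∑ j ∈ s, k j) * ∏ t ∈ T, (ν t : Measure ℝ) (D t) := by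
  have h1 : {ω | ∃ σ, ω ∈ hitEvent ξ D T σ} ⊆
      ⋃ τ : SubConfig k s, hitEvent ξ D T (SubConfig.extend τ) := by
    rintro ω ⟨σ, hσ⟩
    refine mem_iUnion.2 ⟨σ.restrict s, fun t ht => ?_⟩
    rw [restrict_extend_restrict (hT t ht)]
    exact hσ t ht
  refine (measure_mono h1).trans ((measure_iUnion_fintype_le _ _).trans ?_)
  simp only [h.measure_hitEvent hD, Finset.sum_const, Finset.card_univ, card_subConfig,
    nsmul_eq_mul]
  simp

lemma empiricalMeasure_apply {N : ℕ} {ζ : (s : Subsets n) → SubConfig k s.1 → ℝ}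
    {B : Set (Subsets n → ℝ)} (hB : MeasurableSet B) :
    empiricalMeasure N k ζ B = (2 ^ N)⁻¹ *
      ∑ σ : Config k, B.indicator 1 (fun s : Subsets n => ζ s (σ.restrict s.1)) := by
  simp [empiricalMeasure, Measure.dirac_apply' _ hB]

lemma empiricalMeasure_univ {N : ℕ} (hN : ∑ j, k j = N)
    (ζ : (s : Subsets n) → SubConfig k s.1 → ℝ) :
    empiricalMeasure N k ζ univ = 1 := by
  rw [empiricalMeasure_apply MeasurableSet.univ]
  simp only [indicator_univ, Pi.one_apply, Finset.sum_const, Finset.card_univ, card_config, hN]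
  simp [ENNReal.inv_mul_cancel]

lemma empiricalMeasure_pi {Ω : Type*} {ξ : (s : Subsets n) → SubConfig k s.1 → Ω → ℝ} {N : ℕ}
    {D : Subsets n → Set ℝ}
    (hD : ∀ s, MeasurableSet (D s)) (ω : Ω) :
    empiricalMeasure N k (fun s τ => ξ s τ ω) (univ.pi D) = (2 ^ N)⁻¹ *
      ∑ σ : Config k, (hitEvent ξ D Finset.univ σ).indicator 1 ω := by
  rw [empiricalMeasure_apply (MeasurableSet.univ_pi hD)]
  congr 1
  refine Finset.sum_congr rfl fun σ _ => ?_
  have h1 : (fun s : Subsets n => ξ s (σ.restrict s.1) ω) ∈ univ.pi D ↔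
      ω ∈ hitEvent ξ D Finset.univ σ :=
    ⟨fun h t _ => h t (mem_univ t), fun h t _ => h t (Finset.mem_univ t)⟩
  by_cases h2 : ω ∈ hitEvent ξ D Finset.univ σ
  · rw [indicator_of_mem h2, indicator_of_mem (h1.2 h2)]; rfl
  · rw [indicator_of_notMem h2, indicator_of_notMem (mt h1.1 h2)]

lemma IsDisorder.lintegral_empiricalMeasure (h : IsDisorder P k ν ξ) {N : ℕ}
    (hN : ∑ j, k j = N) {D : Subsets n → Set ℝ} (hD : ∀ s, MeasurableSet (D s)) :
    ∫⁻ ω, empiricalMeasure N k (fun s τ => ξ s τ ω) (univ.pi D) ∂P =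
      ∏ t, (ν t : Measure ℝ) (D t) := by
  have hmeas (σ : Config k) := h.measurableSet_hitEvent hD Finset.univ σ
  simp only [empiricalMeasure_pi hD]
  rw [lintegral_const_mul _ (Finset.measurable_sum _ fun σ _ =>
    (measurable_one.indicator (hmeas σ))), lintegral_finsetSum _ fun σ _ =>
    (measurable_one.indicator (hmeas σ))]
  simp only [lintegral_indicator_one (hmeas _), h.measure_hitEvent hD, Finset.sum_const,
    Finset.card_univ, card_config, hN, nsmul_eq_mul]
  rw [← mul_assoc]
  simp [ENNReal.inv_mul_cancel]

lemma IsDisorder.measurable_empiricalMeasure (h : IsDisorder P k ν ξ) {N : ℕ}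
    {D : Subsets n → Set ℝ} (hD : ∀ s, MeasurableSet (D s)) :
    Measurable fun ω => empiricalMeasure N k (fun s τ => ξ s τ ω) (univ.pi D) := by
  have hmeas (σ : Config k) := h.measurableSet_hitEvent hD Finset.univ σ
  simp only [empiricalMeasure_pi hD]
  exact (Finset.measurable_sum _ fun σ _ => measurable_one.indicator (hmeas σ)).const_mul _

/-- Chebyshev's inequality for the number of events of a finite family that occur. -/
lemma measure_sum_indicator_lt_half [IsProbabilityMeasure P] {ι : Type*} [Fintype ι]
    {E : ι → Set Ω} (hE : ∀ i, MeasurableSet (E i)) (hm : 0 < ∑ i, P.real (E i)) :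
    P {ω | ∑ i, (E i).indicator (1 : Ω → ℝ) ω < (∑ i, P.real (E i)) / 2} ≤
      ENNReal.ofReal (4 * (∑ i, ∑ j, (P.real (E i ∩ E j) - P.real (E i) * P.real (E j))) /
        (∑ i, P.real (E i)) ^ 2) := by
  set m := ∑ i, P.real (E i) with hmdef
  set X : Ω → ℝ := fun ω => ∑ i, (E i).indicator (1 : Ω → ℝ) ω with hX
  have hLp (i : ι) : MemLp ((E i).indicator (1 : Ω → ℝ)) 2 P :=
    (memLp_const (1 : ℝ)).indicator (hE i)
  have hXLp : MemLp X 2 P := memLp_finsetSum _ fun i _ => hLp i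
  have hint : P[X] = m := by
    rw [hX, integral_finsetSum _ fun i _ => (hLp i).integrable (by norm_num)]
    simp [integral_indicator_one (hE _), hmdef]
  have hvar : variance X P =
      ∑ i, ∑ j, (P.real (E i ∩ E j) - P.real (E i) * P.real (E j)) := by
    rw [variance_eq_sub hXLp, hint]
    have hsq : X ^ 2 = fun ω => ∑ i, ∑ j, (E i ∩ E j).indicator (1 : Ω → ℝ) ω := by
      funext ω
      simp only [hX, Pi.pow_apply, sq, Finset.sum_mul_sum]
      refine Finset.sum_congr rfl fun i _ => Finset.sum_congr rfl fun j _ => ?_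
      rw [Set.inter_indicator_one]; rfl
    have hI (i j : ι) : Integrable ((E i ∩ E j).indicator (1 : Ω → ℝ)) P :=
      (integrable_const (1 : ℝ)).indicator ((hE i).inter (hE j))
    rw [hsq, integral_finsetSum _ fun i _ => integrable_finsetSum _ fun j _ => hI i j]
    simp only [Finset.sum_sub_distrib, hmdef, sq, Finset.sum_mul_sum]
    congr 1
    refine Finset.sum_congr rfl fun i _ => ?_
    rw [integral_finsetSum _ fun j _ => hI i j]
    simp [integral_indicator_one ((hE i).inter (hE _))]
  have hch := meas_ge_le_variance_div_sq hXLp (c := m / 2) (by positivity)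
  rw [hint, hvar] at hch
  refine (measure_mono fun ω hω => ?_).trans (hch.trans_eq ?_)
  · have : X ω < m / 2 := hω
    simp only [mem_ofPred_eq]
    rw [abs_sub_comm]
    exact le_trans (by linarith) (le_abs_self _)
  · congr 1
    field_simp
    ring

/-- Agreement on `A` pins those blocks and leaves the others free; the product is compared block by
block. -/
lemma pow_sum_mul_card_restrict_eq (A : Finset (Fin n)) (σ : Config k) :
    (∑ σ' : Config k, if σ.restrict A = σ'.restrict A then (1 : ℝ) else 0) *
      2 ^ (∑ j ∈ A, k j) = 2 ^ ∑ j, k j := by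
  classical
  have h1 : (Finset.univ.filter fun σ' : Config k => σ.restrict A = σ'.restrict A) =
      Fintype.piFinset fun j => if j ∈ A then {σ j} else Finset.univ := by
    ext σ'
    simp only [Finset.mem_filter, Finset.mem_univ, true_and, Fintype.mem_piFinset]
    constructor
    · intro h j
      split_ifs with hj
      · rw [Finset.mem_singleton]
        exact (congrFun h ⟨j, hj⟩).symm
      · exact Finset.mem_univ _
    · intro h
      funext j
      have := h j
      rw [if_pos j.2, Finset.mem_singleton] at this
      exact this.symm
  rw [Finset.sum_boole, h1, Fintype.card_piFinset]
  push_cast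
  rw [← Finset.prod_pow_eq_pow_sum, ← Finset.prod_pow_eq_pow_sum, ← Finset.prod_ite_mem_eq A,
    ← Finset.prod_mul_distrib]
  refine Finset.prod_congr rfl fun j _ => ?_
  split_ifs <;> simp

lemma IsDisorder.measureReal_hitEvent_univ (h : IsDisorder P k ν ξ) {D : Subsets n → Set ℝ}
    (hD : ∀ s, MeasurableSet (D s)) (σ : Config k) :
    P.real (hitEvent ξ D Finset.univ σ) = ∏ t, (ν t : Measure ℝ).real (D t) := by
  simp [Measure.real, h.measure_hitEvent hD, ENNReal.toReal_prod]

open Classical in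
/-- The covariance of two of the events is controlled by the set of blocks on which the two
configurations agree. -/
lemma IsDisorder.covariance_hitEvent_le (h : IsDisorder P k ν ξ) {D : Subsets n → Set ℝ}
    (hD : ∀ s, MeasurableSet (D s)) (hq : ∀ s, 0 < (ν s : Measure ℝ).real (D s))
    (σ σ' : Config k) :
    P.real (hitEvent ξ D Finset.univ σ ∩ hitEvent ξ D Finset.univ σ') -
        P.real (hitEvent ξ D Finset.univ σ) * P.real (hitEvent ξ D Finset.univ σ') ≤
      ∑ A : Subsets n, (if σ.restrict A.1 = σ'.restrict A.1 then 1 else 0) *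
        ((∏ s, (ν s : Measure ℝ).real (D s)) ^ 2 *
          ∏ s with s.1 ⊆ A.1, ((ν s : Measure ℝ).real (D s))⁻¹) := by
  set q : Subsets n → ℝ := fun s => (ν s : Measure ℝ).real (D s) with hqdef
  change _ ≤ ∑ A : Subsets n, (if σ.restrict A.1 = σ'.restrict A.1 then 1 else 0) *
    ((∏ s, q s) ^ 2 * ∏ s with s.1 ⊆ A.1, (q s)⁻¹)
  have hq' : ∀ s, 0 < q s := hq
  have hterm (A : Subsets n) : 0 ≤ (if σ.restrict A.1 = σ'.restrict A.1 then (1 : ℝ) else 0) *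
      ((∏ s, q s) ^ 2 * ∏ s with s.1 ⊆ A.1, (q s)⁻¹) := by
    have : 0 ≤ ∏ s with s.1 ⊆ A.1, (q s)⁻¹ :=
      Finset.prod_nonneg fun s _ => (inv_pos.2 (hq' s)).le
    split_ifs <;> positivity
  have hpair : P.real (hitEvent ξ D Finset.univ σ ∩ hitEvent ξ D Finset.univ σ') =
      (∏ s, q s) ^ 2 * ∏ s with σ.restrict s.1 = σ'.restrict s.1, (q s)⁻¹ := by
    rw [Measure.real, h.measure_hitEvent_inter hD, ENNReal.toReal_prod, Finset.prod_filter,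
      ← Finset.prod_pow, ← Finset.prod_mul_distrib]
    refine Finset.prod_congr rfl fun s _ => ?_
    rw [ENNReal.toReal_pow]
    change q s ^ _ = _
    have := (hq' s).ne'
    split_ifs
    · field_simp
    · simp
  rw [hpair, h.measureReal_hitEvent_univ hD, h.measureReal_hitEvent_univ hD]
  change _ - (∏ s, q s) * (∏ s, q s) ≤ _
  set A : Finset (Fin n) := Finset.univ.filter fun j => σ j = σ' j with hA
  have hiff (s : Subsets n) : σ.restrict s.1 = σ'.restrict s.1 ↔ s.1 ⊆ A := by
    constructor
    · intro hs j hj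
      exact Finset.mem_filter.2 ⟨Finset.mem_univ _, congrFun hs ⟨j, hj⟩⟩
    · intro hs
      funext j
      exact (Finset.mem_filter.1 (hs j.2)).2
  -- With no common block the events are independent and the covariance is zero. Otherwise the
  -- summand of the agreement set `A` alone dominates, after dropping the subtracted square.
  rcases A.eq_empty_or_nonempty with hAe | hAn
  · have hempty : (Finset.univ.filter fun s : Subsets n =>
        σ.restrict s.1 = σ'.restrict s.1) = ∅ := by
      refine Finset.filter_eq_empty_iff.2 fun s _ hs => ?_
      have h1 := (hiff s).1 hs
      rw [hAe, Finset.subset_empty] at h1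
      exact s.2.ne_empty h1
    rw [hempty, Finset.prod_empty, mul_one, ← sq, sub_self]
    exact Finset.sum_nonneg fun A _ => hterm A
  · have h1 := Finset.single_le_sum (fun A _ => hterm A) (Finset.mem_univ (⟨A, hAn⟩ : Subsets n))
    refine le_trans ?_ h1
    rw [if_pos ((hiff ⟨A, hAn⟩).2 subset_rfl), one_mul, Finset.filter_congr fun s _ => hiff s]
    have : 0 < ∏ s, q s := Finset.prod_pos fun s _ => hq' s
    nlinarith

/-- Chebyshev's inequality, with the covariances summed by agreement set. The square of the mean
count 2^N ∏ q_s cancels, leaving only entropy against cost for each `A`. -/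
lemma IsDisorder.measure_empiricalMeasure_lt_half [IsProbabilityMeasure P]
    (h : IsDisorder P k ν ξ) {N : ℕ} (hN : ∑ j, k j = N) {D : Subsets n → Set ℝ}
    (hD : ∀ s, MeasurableSet (D s)) (hq : ∀ s, 0 < (ν s : Measure ℝ).real (D s)) :
    P {ω | empiricalMeasure N k (fun s τ => ξ s τ ω) (univ.pi D) <
        ENNReal.ofReal ((∏ s, (ν s : Measure ℝ).real (D s)) / 2)} ≤
      ENNReal.ofReal (4 * ∑ A : Subsets n, (2 ^ ∑ j ∈ A.1, k j)⁻¹ *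
        ∏ s with s.1 ⊆ A.1, ((ν s : Measure ℝ).real (D s))⁻¹) := by
  set q : Subsets n → ℝ := fun s => (ν s : Measure ℝ).real (D s) with hqdef
  set Q : ℝ := ∏ s, q s with hQ
  have hQpos : 0 < Q := Finset.prod_pos fun s _ => hq s
  have hsum : ∑ σ : Config k, P.real (hitEvent ξ D Finset.univ σ) = 2 ^ N * Q := by
    simp only [h.measureReal_hitEvent_univ hD, Finset.sum_const, Finset.card_univ, card_config, hN,
      nsmul_eq_mul]
    push_cast; rfl
  have hcheb := measure_sum_indicator_lt_half (P := P)
    (fun σ : Config k => h.measurableSet_hitEvent hD Finset.univ σ)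
    (by rw [hsum]; positivity)
  rw [hsum] at hcheb
  have hset : {ω | empiricalMeasure N k (fun s τ => ξ s τ ω) (univ.pi D) <
      ENNReal.ofReal (Q / 2)} ⊆ {ω | ∑ σ : Config k,
        (hitEvent ξ D Finset.univ σ).indicator (1 : Ω → ℝ) ω < 2 ^ N * Q / 2} := by
    intro ω hω
    have h1 : empiricalMeasure N k (fun s τ => ξ s τ ω) (univ.pi D) = ENNReal.ofReal ((2 ^ N)⁻¹ *
        ∑ σ : Config k, (hitEvent ξ D Finset.univ σ).indicator (1 : Ω → ℝ) ω) := by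
      rw [empiricalMeasure_pi hD, ENNReal.ofReal_mul (by positivity),
        ENNReal.ofReal_inv_of_pos (by positivity), ENNReal.ofReal_pow (by norm_num),
        ENNReal.ofReal_sum_of_nonneg fun σ _ => indicator_nonneg (by simp) _]
      congr 1
      · simp
      · refine Finset.sum_congr rfl fun σ _ => ?_
        by_cases h2 : ω ∈ hitEvent ξ D Finset.univ σ <;> simp [h2]
    rw [mem_ofPred_eq, h1, ENNReal.ofReal_lt_ofReal_iff (by positivity)] at hω
    rw [mem_ofPred_eq]
    rw [inv_mul_lt_iff₀ (by positivity)] at hω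
    linarith
  refine (measure_mono hset).trans (hcheb.trans (ENNReal.ofReal_le_ofReal ?_))
  rw [mul_div_assoc]
  refine mul_le_mul_of_nonneg_left ?_ (by norm_num)
  rw [div_le_iff₀ (by positivity)]
  calc ∑ σ : Config k, ∑ σ' : Config k,
        (P.real (hitEvent ξ D Finset.univ σ ∩ hitEvent ξ D Finset.univ σ') -
          P.real (hitEvent ξ D Finset.univ σ) * P.real (hitEvent ξ D Finset.univ σ'))
      ≤ ∑ σ : Config k, ∑ σ' : Config k, ∑ A : Subsets n,
        (if σ.restrict A.1 = σ'.restrict A.1 then 1 else 0) *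
          (Q ^ 2 * ∏ s with s.1 ⊆ A.1, (q s)⁻¹) := by
        refine Finset.sum_le_sum fun σ _ => Finset.sum_le_sum fun σ' _ => ?_
        convert h.covariance_hitEvent_le hD hq σ σ'
    _ = ∑ A : Subsets n, ∑ σ : Config k, 2 ^ N * (2 ^ ∑ j ∈ A.1, k j)⁻¹ *
          (Q ^ 2 * ∏ s with s.1 ⊆ A.1, (q s)⁻¹) := by
        rw [Finset.sum_comm (γ := Subsets n)]
        refine Finset.sum_congr rfl fun σ _ => ?_
        rw [Finset.sum_comm]
        refine Finset.sum_congr rfl fun A _ => ?_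
        rw [← Finset.sum_mul, ← hN, ← pow_sum_mul_card_restrict_eq A.1 σ]
        congr 1
        field_simp
    _ = (∑ A : Subsets n, (2 ^ ∑ j ∈ A.1, k j)⁻¹ * ∏ s with s.1 ⊆ A.1, (q s)⁻¹) *
          (2 ^ N * Q) ^ 2 := by
        simp only [Finset.sum_const, Finset.card_univ, card_config, hN, nsmul_eq_mul,
          Finset.sum_mul]
        refine Finset.sum_congr rfl fun A _ => ?_
        push_cast
        ring

end BKM

/-! ### Almost sure exponential bounds for a fixed box -/

namespace BKM

variable {Ω : Type*} [MeasurableSpace Ω] {P : Measure Ω} {n : ℕ} {k : ℕ → Fin n → ℕ}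
  {p : Fin n → ℝ} {law : Subsets n → ℕ → ProbabilityMeasure ℝ}
  {ξ : (N : ℕ) → (s : Subsets n) → SubConfig (k N) s.1 → Ω → ℝ}

lemma tendsto_sum_mul_log_two
    (hkp : ∀ j, Tendsto (fun N : ℕ => (k N j : ℝ) / (N : ℝ)) atTop (𝓝 (p j)))
    (s : Finset (Fin n)) :
    Tendsto (fun N : ℕ => (∑ j ∈ s, (k N j : ℝ)) * Real.log 2 / N) atTop
      (𝓝 (∑ j ∈ s, p j * Real.log 2)) := by
  have h1 := tendsto_finsetSum s fun j _ => (hkp j).mul_const (Real.log 2)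
  refine h1.congr fun N => ?_
  rw [Finset.sum_mul, Finset.sum_div]
  exact Finset.sum_congr rfl fun j _ => by ring

lemma two_pow_sum_eq_exp (s : Finset (Fin n)) (N : ℕ) :
    (2 : ℝ) ^ (∑ j ∈ s, k N j) = Real.exp ((∑ j ∈ s, (k N j : ℝ)) * Real.log 2) := by
  rw [mul_comm, ← Nat.cast_sum, Real.exp_mul, Real.exp_log (by norm_num), Real.rpow_natCast]

lemma eventually_two_pow_le_exp
    (hkp : ∀ j, Tendsto (fun N : ℕ => (k N j : ℝ) / (N : ℝ)) atTop (𝓝 (p j)))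
    (s : Finset (Fin n)) {r : ℝ} (hr : ∑ j ∈ s, p j * Real.log 2 < r) :
    ∀ᶠ N : ℕ in atTop, (2 : ℝ) ^ (∑ j ∈ s, k N j) ≤ Real.exp (N * r) := by
  filter_upwards [(tendsto_sum_mul_log_two hkp s).eventually_lt_const hr, eventually_gt_atTop 0]
    with N hN h0
  rw [two_pow_sum_eq_exp, Real.exp_le_exp]
  rw [div_lt_iff₀ (by exact_mod_cast h0)] at hN
  linarith

lemma eventually_exp_le_two_pow
    (hkp : ∀ j, Tendsto (fun N : ℕ => (k N j : ℝ) / (N : ℝ)) atTop (𝓝 (p j)))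
    (s : Finset (Fin n)) {r : ℝ} (hr : r < ∑ j ∈ s, p j * Real.log 2) :
    ∀ᶠ N : ℕ in atTop, Real.exp (N * r) ≤ (2 : ℝ) ^ (∑ j ∈ s, k N j) := by
  filter_upwards [(tendsto_sum_mul_log_two hkp s).eventually_const_lt hr, eventually_gt_atTop 0]
    with N hN h0
  rw [two_pow_sum_eq_exp, Real.exp_le_exp]
  rw [lt_div_iff₀ (by exact_mod_cast h0)] at hN
  linarith

lemma eventually_prod_le {T : Finset (Subsets n)} {D : Subsets n → Set ℝ} {w : Subsets n → ℝ}
    (hw : ∀ t ∈ T, ∀ᶠ N : ℕ in atTop,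
      (law t N : Measure ℝ) (D t) ≤ ENNReal.ofReal (Real.exp (-(N * w t)))) :
    ∀ᶠ N : ℕ in atTop, ∏ t ∈ T, (law t N : Measure ℝ) (D t) ≤
      ENNReal.ofReal (Real.exp (-(N * ∑ t ∈ T, w t))) := by
  filter_upwards [(Finset.eventually_all T).2 hw] with N hN
  refine (Finset.prod_le_prod' hN).trans_eq ?_
  rw [← ENNReal.ofReal_prod_of_nonneg fun t _ => (Real.exp_pos _).le, ← Real.exp_sum,
    Finset.sum_neg_distrib, Finset.mul_sum]

variable [IsProbabilityMeasure P]

/-- If the costs of the events `ξ(t, ·) ∈ D t`, `t ⊆ s`, exceed the entropy of the blocks in `s`,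
then almost surely no configuration realises all of them for large `N`. -/
lemma ae_eventually_notMem_hitEvent
    (hkp : ∀ j, Tendsto (fun N : ℕ => (k N j : ℝ) / (N : ℝ)) atTop (𝓝 (p j)))
    (hdis : ∀ᶠ N in atTop, IsDisorder P (k N) (fun s => law s N) (ξ N))
    {D : Subsets n → Set ℝ} (hD : ∀ s, MeasurableSet (D s))
    (s : Finset (Fin n)) {T : Finset (Subsets n)} (hT : ∀ t ∈ T, t.1 ⊆ s) {w : Subsets n → ℝ}
    (hw : ∀ t ∈ T, ∀ᶠ N : ℕ in atTop,
      (law t N : Measure ℝ) (D t) ≤ ENNReal.ofReal (Real.exp (-(N * w t))))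
    (hlt : ∑ j ∈ s, p j * Real.log 2 < ∑ t ∈ T, w t) :
    ∀ᵐ ω ∂P, ∀ᶠ N in atTop, ∀ σ : Config (k N), ω ∉ hitEvent (ξ N) D T σ := by
  obtain ⟨r, hr1, hr2⟩ := exists_between hlt
  have h1 : ∀ᶠ N : ℕ in atTop, P {ω | ∃ σ : Config (k N), ω ∈ hitEvent (ξ N) D T σ} ≤
      ENNReal.ofReal (Real.exp (-(N * (∑ t ∈ T, w t - r)))) := by
    filter_upwards [hdis, eventually_prod_le hw, eventually_two_pow_le_exp hkp s hr1]
      with N hN hprod h2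
    refine (hN.measure_exists_le hD s hT).trans ?_
    have h3 : (2 : ℝ≥0∞) ^ (∑ j ∈ s, k N j) ≤ ENNReal.ofReal (Real.exp (N * r)) := by
      refine le_trans (le_of_eq ?_) (ENNReal.ofReal_le_ofReal h2)
      rw [ENNReal.ofReal_pow (by norm_num)]; simp
    refine (mul_le_mul' h3 hprod).trans_eq ?_
    rw [← ENNReal.ofReal_mul (by positivity), ← Real.exp_add]
    ring_nf
  have h2 := ae_eventually_not_of_summable (summable_of_eventually_le_exp
    (fun N => (Real.exp_pos _).le) (sub_pos.2 hr2) (Eventually.of_forall fun N => le_rfl)) h1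
  simpa using h2

/-- Markov's inequality: the gap between `r` and ∑ w makes the failure probabilities summable. -/
lemma ae_eventually_empiricalMeasure_le (hk : ∀ᶠ N in atTop, ∑ j, k N j = N)
    (hdis : ∀ᶠ N in atTop, IsDisorder P (k N) (fun s => law s N) (ξ N))
    {D : Subsets n → Set ℝ} (hD : ∀ s, MeasurableSet (D s)) {w : Subsets n → ℝ}
    (hw : ∀ t, ∀ᶠ N : ℕ in atTop,
      (law t N : Measure ℝ) (D t) ≤ ENNReal.ofReal (Real.exp (-(N * w t))))
    {r : ℝ} (hr : r < ∑ t, w t) :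
    ∀ᵐ ω ∂P, ∀ᶠ N : ℕ in atTop, empiricalMeasure N (k N) (fun s τ => ξ N s τ ω) (univ.pi D) ≤
      ENNReal.ofReal (Real.exp (-(N * r))) := by
  have h1 : ∀ᶠ N : ℕ in atTop, P {ω | ENNReal.ofReal (Real.exp (-(N * r))) <
      empiricalMeasure N (k N) (fun s τ => ξ N s τ ω) (univ.pi D)} ≤
      ENNReal.ofReal (Real.exp (-(N * (∑ t, w t - r)))) := by
    filter_upwards [hk, hdis, eventually_prod_le (T := Finset.univ) fun t _ => hw t]
      with N hkN hN hprod
    have hM := mul_meas_ge_le_lintegral (μ := P) (hN.measurable_empiricalMeasure (N := N) hD)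
      (ENNReal.ofReal (Real.exp (-(N * r))))
    rw [hN.lintegral_empiricalMeasure hkN hD] at hM
    have h2 := hM.trans hprod
    have h3 : ENNReal.ofReal (Real.exp (-(N * r))) *
        ENNReal.ofReal (Real.exp (-(N * (∑ t, w t - r)))) =
        ENNReal.ofReal (Real.exp (-(N * ∑ t, w t))) := by
      rw [← ENNReal.ofReal_mul (by positivity), ← Real.exp_add]
      ring_nf
    rw [← h3] at h2
    rw [ENNReal.mul_le_mul_iff_right (by simp [Real.exp_pos]) (by simp)] at h2
    refine (measure_mono ?_).trans h2
    intro ω hω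
    rw [mem_ofPred_eq] at hω ⊢
    exact hω.le
  have h2 := ae_eventually_not_of_summable (summable_of_eventually_le_exp
    (fun N => (Real.exp_pos _).le) (sub_pos.2 hr) (Eventually.of_forall fun N => le_rfl)) h1
  simpa using h2

/-- The strict constraint at each `A` makes the corresponding Chebyshev term decay exponentially. -/
lemma ae_eventually_le_empiricalMeasure
    (hkp : ∀ j, Tendsto (fun N : ℕ => (k N j : ℝ) / (N : ℝ)) atTop (𝓝 (p j)))
    (hk : ∀ᶠ N in atTop, ∑ j, k N j = N)
    (hdis : ∀ᶠ N in atTop, IsDisorder P (k N) (fun s => law s N) (ξ N))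
    {D : Subsets n → Set ℝ} (hD : ∀ s, MeasurableSet (D s)) {w : Subsets n → ℝ}
    (hw : ∀ t, ∀ᶠ N : ℕ in atTop,
      ENNReal.ofReal (Real.exp (-(N * w t))) ≤ (law t N : Measure ℝ) (D t))
    (hlt : ∀ s : Subsets n, ∑ t with t.1 ⊆ s.1, w t < ∑ j ∈ s.1, p j * Real.log 2)
    {r : ℝ} (hr : ∑ t, w t < r) :
    ∀ᵐ ω ∂P, ∀ᶠ N : ℕ in atTop, ENNReal.ofReal (Real.exp (-(N * r))) ≤
      empiricalMeasure N (k N) (fun s τ => ξ N s τ ω) (univ.pi D) := by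
  have hreal : ∀ᶠ N : ℕ in atTop, ∀ t,
      Real.exp (-(N * w t)) ≤ (law t N : Measure ℝ).real (D t) := by
    filter_upwards [eventually_all.2 hw] with N hN t
    exact (ENNReal.ofReal_le_iff_le_toReal (measure_ne_top _ _)).1 (hN t)
  set f : ℕ → ℝ := fun N => 4 * ∑ A : Subsets n, (2 ^ ∑ j ∈ A.1, k N j)⁻¹ *
    ∏ s with s.1 ⊆ A.1, ((law s N : Measure ℝ).real (D s))⁻¹ with hf
  have hsummable : Summable f := by
    refine Summable.mul_left _ (summable_sum fun A _ => ?_)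
    obtain ⟨c, hc1, hc2⟩ := exists_between (hlt A)
    refine summable_of_eventually_le_exp (fun N => by positivity) (sub_pos.2 hc1) ?_
    filter_upwards [hreal, eventually_exp_le_two_pow hkp A.1 hc2] with N hN h2
    calc (2 ^ ∑ j ∈ A.1, k N j)⁻¹ * ∏ s with s.1 ⊆ A.1, ((law s N : Measure ℝ).real (D s))⁻¹
        ≤ (Real.exp (N * c))⁻¹ * ∏ s : Subsets n with s.1 ⊆ A.1, (Real.exp (-(N * w s)))⁻¹ := by
          gcongr with s _
          · exact hN s
      _ = Real.exp (-(N * (c - ∑ t with t.1 ⊆ A.1, w t))) := by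
          simp only [← Real.exp_neg, ← Real.exp_sum, ← Real.exp_add, neg_neg, Finset.mul_sum,
            mul_sub]
          ring_nf
  have h1 : ∀ᶠ N in atTop, P {ω | empiricalMeasure N (k N) (fun s τ => ξ N s τ ω) (univ.pi D) <
      ENNReal.ofReal ((∏ s, (law s N : Measure ℝ).real (D s)) / 2)} ≤ ENNReal.ofReal (f N) := by
    filter_upwards [hk, hdis, hreal] with N hkN hN hq
    exact hN.measure_empiricalMeasure_lt_half hkN hD fun s => (Real.exp_pos _).trans_le (hq s)
  filter_upwards [ae_eventually_not_of_summable hsummable h1] with ω hω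
  -- The factor 2 pays for the bound by half of the mean.
  filter_upwards [hω, hreal, eventually_mul_exp_le 2 hr] with N hN hq h2
  refine le_trans (ENNReal.ofReal_le_ofReal ?_) (not_lt.1 hN)
  have h3 : Real.exp (-(N * ∑ t, w t)) ≤ ∏ s, (law s N : Measure ℝ).real (D s) := by
    rw [Finset.mul_sum, ← Finset.sum_neg_distrib, Real.exp_sum]
    exact Finset.prod_le_prod (fun s _ => (Real.exp_pos _).le) fun s _ => hq s
  push_cast at h2
  linarith

end BKM

namespace BKM

/-! ### Semicontinuity and convexity of the rate functions -/

section RateFunctions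

variable {n : ℕ} {p : Fin n → ℝ} {I : Subsets n → ℝ → ℝ≥0∞}

lemma isClosed_rateSupport (hI : ∀ s, LowerSemicontinuous (I s)) :
    IsClosed (rateSupport p I) := by
  have : rateSupport p I = ⋂ s : Subsets n,
      (fun x : Subsets n → ℝ => ∑ t with t.1 ⊆ s.1, I t (x t)) ⁻¹'
        Iic (ENNReal.ofReal (∑ j ∈ s.1, p j * Real.log 2)) := by
    ext x; simp [rateSupport]
  rw [this]
  exact isClosed_iInter fun s => (lowerSemicontinuous_sum fun t _ =>
    (hI t).comp (continuous_apply t)).isClosed_preimage _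

lemma rateJ_of_mem {x : Subsets n → ℝ} (hx : x ∈ rateSupport p I) :
    rateJ p I x = ∑ s, I s (x s) := if_pos hx

lemma rateJ_of_notMem {x : Subsets n → ℝ} (hx : x ∉ rateSupport p I) :
    rateJ p I x = ∞ := if_neg hx

lemma isRateFunction_rateJ (hI : ∀ s, LowerSemicontinuous (I s)) :
    IsRateFunction (rateJ p I) := by
  refine lowerSemicontinuous_iff_isClosed_preimage.2 fun y => ?_
  rcases eq_or_ne y ∞ with rfl | hy
  · simp
  have : rateJ p I ⁻¹' Iic y =
      rateSupport p I ∩ (fun x : Subsets n → ℝ => ∑ s, I s (x s)) ⁻¹' Iic y := by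
    ext x
    by_cases hx : x ∈ rateSupport p I
    · simp [hx, rateJ_of_mem]
    · simp [hx, rateJ_of_notMem, hy]
  rw [this]
  exact (isClosed_rateSupport hI).inter ((lowerSemicontinuous_sum fun t _ =>
    (hI t).comp (continuous_apply t)).isClosed_preimage _)

lemma exists_lt_of_lt_sum {ι : Type*} {T : Finset ι} {v : ι → ℝ≥0∞} {r : ℝ}
    (hr : (r : EReal) < ((∑ t ∈ T, v t : ℝ≥0∞) : EReal)) :
    ∃ w : ι → ℝ, (∀ t ∈ T, (w t : EReal) < v t) ∧ r < ∑ t ∈ T, w t := by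
  -- Infinite values are cut at |r| + 1, which alone already exceeds `r`.
  set u : ι → ℝ := fun t => if v t = ∞ then |r| + 1 else (v t).toReal with hu
  have hsum : r < ∑ t ∈ T, u t := by
    by_cases h : ∃ t ∈ T, v t = ∞
    · obtain ⟨t, ht, hvt⟩ := h
      have h1 := Finset.single_le_sum (f := u) (fun i _ => by simp only [hu]; split_ifs <;> positivity) ht
      have h2 : u t = |r| + 1 := if_pos hvt
      linarith [le_abs_self r]
    · push Not at h
      have h1 : ∑ t ∈ T, u t = (∑ t ∈ T, v t).toReal := by
        rw [ENNReal.toReal_sum h]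
        exact Finset.sum_congr rfl fun t ht => if_neg (h t ht)
      rwa [h1, ← EReal.coe_lt_coe_iff, ← max_eq_left (ENNReal.toReal_nonneg (a := ∑ t ∈ T, v t)),
        ← EReal.coe_ennreal_ofReal, ENNReal.ofReal_toReal (ENNReal.sum_ne_top.2 h)]
  -- The excess is split into card + 1 shares: one is taken from each term, and the last keeps the
  -- inequality strict.
  set δ : ℝ := (∑ t ∈ T, u t - r) / (T.card + 1) with hδ
  have hδ0 : 0 < δ := div_pos (by linarith) (by positivity)
  have hδ1 : δ * (T.card + 1) = ∑ t ∈ T, u t - r := by rw [hδ]; field_simp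
  refine ⟨fun t => u t - δ, fun t ht => ?_, ?_⟩
  · by_cases h : v t = ∞
    · rw [h]; exact EReal.coe_lt_top _
    · have h1 : u t = (v t).toReal := if_neg h
      rw [← ENNReal.ofReal_toReal h, EReal.coe_ennreal_ofReal, max_eq_left ENNReal.toReal_nonneg,
        EReal.coe_lt_coe_iff]
      linarith
  · rw [Finset.sum_sub_distrib, Finset.sum_const, nsmul_eq_mul]
    linarith

lemma rate_smul_le {f : ℝ → ℝ≥0∞} (hf : ConvexOn ℝ≥0 univ f) (h0 : f 0 = 0) {θ : ℝ≥0}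
    (hθ : θ ≤ 1) (x : ℝ) : f (θ * x) ≤ θ * f x := by
  have := hf.2 (mem_univ x) (mem_univ (0 : ℝ)) (zero_le (a := θ)) (zero_le (a := 1 - θ))
    (add_tsub_cancel_of_le hθ)
  simpa [h0, NNReal.smul_def, ENNReal.smul_def] using this

lemma rate_le_rate_of_mul_eq {f : ℝ → ℝ≥0∞} (hf : ConvexOn ℝ≥0 univ f) (h0 : f 0 = 0) {θ : ℝ}
    (hθ0 : 0 ≤ θ) (hθ : θ ≤ 1) {x y : ℝ} (h : x = θ * y) : f x ≤ f y := by
  lift θ to ℝ≥0 using hθ0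
  have hθ : θ ≤ 1 := by exact_mod_cast hθ
  rw [h]
  refine (rate_smul_le hf h0 hθ y).trans (mul_le_of_le_one_left' ?_)
  exact_mod_cast hθ

lemma rate_mono_of_nonneg {f : ℝ → ℝ≥0∞} (hf : ConvexOn ℝ≥0 univ f) (h0 : f 0 = 0) {x y : ℝ}
    (hx : 0 ≤ x) (hxy : x ≤ y) : f x ≤ f y := by
  rcases hx.eq_or_lt with rfl | hx
  · simp [h0]
  · have hy : 0 < y := hx.trans_le hxy
    exact rate_le_rate_of_mul_eq hf h0 (by positivity) ((div_le_one hy).2 hxy)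
      (div_mul_cancel₀ x hy.ne').symm

lemma rate_anti_of_nonpos {f : ℝ → ℝ≥0∞} (hf : ConvexOn ℝ≥0 univ f) (h0 : f 0 = 0) {x y : ℝ}
    (hx : x ≤ 0) (hxy : y ≤ x) : f x ≤ f y := by
  rcases hx.eq_or_lt with rfl | hx
  · simp [h0]
  · have hy : y < 0 := hxy.trans_lt hx
    exact rate_le_rate_of_mul_eq hf h0 (div_pos_of_neg_of_neg hx hy).le
      ((div_le_one_of_neg hy).2 hxy) (div_mul_cancel₀ x hy.ne).symm

/-- A convex rate function vanishing at `0` that is bounded along a ray vanishes on the ray. -/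
lemma rate_eq_zero_of_bounded {f : ℝ → ℝ≥0∞} (hf : ConvexOn ℝ≥0 univ f) (h0 : f 0 = 0) {x : ℝ}
    {C : ℝ≥0∞} (hC : C ≠ ∞) (h : ∀ m : ℕ, f ((m + 1) * x) ≤ C) : f x = 0 := by
  refine le_antisymm ?_ zero_le
  have h1 (m : ℕ) : f x ≤ ((m : ℝ≥0∞) + 1)⁻¹ * C := by
    -- Convexity between 0 and (m + 1)x gives f(x) ≤ C / (m + 1), which tends to 0.
    have h2 := rate_smul_le hf h0 (θ := ((m : ℝ≥0) + 1)⁻¹)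
      (inv_le_one_of_one_le₀ (by simp)) ((m + 1) * x)
    have h3 : (((m : ℝ≥0) + 1)⁻¹ : ℝ≥0) * (((m : ℝ) + 1) * x) = x := by
      push_cast
      field_simp
    rw [h3, ENNReal.coe_inv (by positivity)] at h2
    push_cast at h2
    exact h2.trans (mul_le_mul_right (h m) _)
  have h2 : Tendsto (fun m : ℕ => ((m : ℝ≥0∞) + 1)⁻¹ * C) atTop (𝓝 (0 * C)) := by
    refine ENNReal.Tendsto.mul_const ?_ (Or.inr hC)
    have := (tendsto_add_atTop_iff_nat 1).2 ENNReal.tendsto_inv_nat_nhds_zero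
    simpa using this
  rw [zero_mul] at h2
  exact ge_of_tendsto' h2 h1

end RateFunctions

/-! ### Consequences of the LDP for a single law -/

section Laws

variable {μ : ℕ → ProbabilityMeasure ℝ} {f : ℝ → ℝ≥0∞}

lemma eventually_le_of_forall_le (h : SatisfiesLDP (fun N => (μ N : Measure ℝ)) f) {F : Set ℝ}
    (hF : IsClosed F) {c : ℝ≥0∞} (hc : ∀ y ∈ F, c ≤ f y) {w : ℝ} (hw : (w : EReal) < c) :
    ∀ᶠ N : ℕ in atTop, (μ N : Measure ℝ) F ≤ ENNReal.ofReal (Real.exp (-(N * w))) :=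
  h.eventually_le hF (coe_lt_infRate_of_forall hw hc)

lemma exists_nhds_eventually_le (h : SatisfiesLDP (fun N => (μ N : Measure ℝ)) f) {x w : ℝ}
    (hw : (w : EReal) < f x) :
    ∃ U ∈ 𝓝 x, ∀ᶠ N : ℕ in atTop,
      (μ N : Measure ℝ) U ≤ ENNReal.ofReal (Real.exp (-(N * w))) := by
  -- For negative `w` the bound is at least 1, hence trivial for a probability. Otherwise
  -- semicontinuity supplies a neighbourhood, taken closed so that the upper bound applies.
  rcases lt_or_ge w 0 with h0 | h0
  · refine ⟨univ, univ_mem, Eventually.of_forall fun N => ?_⟩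
    rw [measure_univ, ENNReal.one_le_ofReal, Real.one_le_exp_iff]
    have : (0 : ℝ) ≤ N := Nat.cast_nonneg N
    nlinarith
  · have h1 : ENNReal.ofReal w < f x := by
      rw [← EReal.coe_ennreal_lt_coe_ennreal_iff, EReal.coe_ennreal_ofReal, max_eq_left h0]
      exact hw
    obtain ⟨c, hc1, hc2⟩ := exists_between h1
    obtain ⟨U, ⟨hU, hUc⟩, hUs⟩ := (closed_nhds_basis x).mem_iff.1 (h.rate x c hc2)
    refine ⟨U, hU, eventually_le_of_forall_le h hUc (c := c) (fun y hy => (hUs hy).le) ?_⟩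
    rwa [← EReal.coe_ennreal_lt_coe_ennreal_iff, EReal.coe_ennreal_ofReal, max_eq_left h0] at hc1

/-- If f(0) were positive, the mass near 0 would decay exponentially, while weak convergence keeps
it above 1/2. -/
lemma rate_zero_eq_zero (h : SatisfiesLDP (fun N => (μ N : Measure ℝ)) f)
    (hμ : Tendsto μ atTop (𝓝 (diracProba (0 : ℝ)))) : f 0 = 0 := by
  by_contra hne
  obtain ⟨w, hw0, hw⟩ := EReal.lt_iff_exists_real_btwn.1
    (show (0 : EReal) < f 0 from EReal.coe_ennreal_pos.2 (pos_iff_ne_zero.2 hne))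
  have hw0 : 0 < w := by exact_mod_cast hw0
  obtain ⟨U, hU, hle⟩ := exists_nhds_eventually_le h hw
  obtain ⟨V, hVU, hV, h0V⟩ := mem_nhds_iff.1 hU
  have h1 := ProbabilityMeasure.le_liminf_measure_open_of_tendsto hμ hV
  have h2 : ((diracProba (0 : ℝ) : ProbabilityMeasure ℝ) : Measure ℝ) V = 1 := by
    simp [diracProba, h0V]
  rw [h2] at h1
  have h3 : ∀ᶠ N in atTop, (1 / 2 : ℝ≥0∞) < (μ N : Measure ℝ) V :=
    eventually_lt_of_lt_liminf (lt_of_lt_of_le (by simp) h1)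
      (by isBoundedDefault)
  have h4 : ∀ᶠ N : ℕ in atTop, (2 : ℕ) * Real.exp (-(N * w)) ≤ Real.exp (-(N * 0)) :=
    eventually_mul_exp_le 2 hw0
  obtain ⟨N, h3, h4, hle⟩ := (h3.and (h4.and hle)).exists
  have h5 := h3.trans_le ((measure_mono hVU).trans hle)
  rw [← ENNReal.ofReal_one, ← ENNReal.ofReal_ofNat, ← ENNReal.ofReal_div_of_pos (by norm_num),
    ENNReal.ofReal_lt_ofReal_iff (Real.exp_pos _)] at h5
  simp at h4
  linarith

end Laws

/-- The open box with the given rational faces. -/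
def ratBox {ι : Type*} (b : ι → ℚ × ℚ) : Set (ι → ℝ) :=
  univ.pi fun i => Ioo ((b i).1 : ℝ) ((b i).2 : ℝ)

lemma exists_rat_Ioo_subset {x : ℝ} {U : Set ℝ} (hU : U ∈ 𝓝 x) :
    ∃ b : ℚ × ℚ, x ∈ Ioo (b.1 : ℝ) (b.2 : ℝ) ∧ Ioo (b.1 : ℝ) (b.2 : ℝ) ⊆ U := by
  obtain ⟨l, u, ⟨hl, hu⟩, hs⟩ := mem_nhds_iff_exists_Ioo_subset.1 hU
  obtain ⟨a, ha1, ha2⟩ := exists_rat_btwn hl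
  obtain ⟨b, hb1, hb2⟩ := exists_rat_btwn hu
  exact ⟨(a, b), ⟨ha2, hb1⟩, (Ioo_subset_Ioo ha1.le hb2.le).trans hs⟩

lemma ratBox_mem_nhds {ι : Type*} [Finite ι] {b : ι → ℚ × ℚ} {x : ι → ℝ} (hx : x ∈ ratBox b) :
    ratBox b ∈ 𝓝 x :=
  (isOpen_set_pi finite_univ fun _ _ => isOpen_Ioo).mem_nhds hx

lemma exists_ratBox_subset {ι : Type*} [Finite ι] {x : ι → ℝ} {G : Set (ι → ℝ)} (hG : G ∈ 𝓝 x) :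
    ∃ b : ι → ℚ × ℚ, x ∈ ratBox b ∧ ratBox b ⊆ G := by
  rw [nhds_pi, Filter.mem_pi'] at hG
  obtain ⟨T, V, hV, hs⟩ := hG
  choose b hb1 hb2 using fun i => exists_rat_Ioo_subset (hV i)
  exact ⟨b, fun i _ => hb1 i, fun y hy => hs fun i _ => hb2 i (hy i (mem_univ i))⟩

end BKM

/-! ### From boxes to the weak and the full principle -/

namespace BKM

variable {Ω : Type*} [MeasurableSpace Ω] {P : Measure Ω} [IsProbabilityMeasure P]
  {n : ℕ} {k : ℕ → Fin n → ℕ}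
  {p : Fin n → ℝ} {law : Subsets n → ℕ → ProbabilityMeasure ℝ} {I : Subsets n → ℝ → ℝ≥0∞}
  {ξ : (N : ℕ) → (s : Subsets n) → SubConfig (k N) s.1 → Ω → ℝ}

lemma measurableSet_Ioo_rat {ι : Type*} (b : ι → ℚ × ℚ) (i : ι) :
    MeasurableSet (Ioo ((b i).1 : ℝ) ((b i).2 : ℝ)) := measurableSet_Ioo

lemma exists_ratBox_ae_eventually_le
    (hkp : ∀ j, Tendsto (fun N : ℕ => (k N j : ℝ) / (N : ℝ)) atTop (𝓝 (p j)))
    (hk : ∀ᶠ N in atTop, ∑ j, k N j = N)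
    (hdis : ∀ᶠ N in atTop, IsDisorder P (k N) (fun s => law s N) (ξ N))
    (hp : ∀ j, 0 < p j)
    (hLDP : ∀ s, SatisfiesLDP (fun N => (law s N : Measure ℝ)) (I s))
    {x : Subsets n → ℝ} {r : ℝ} (hr : (r : EReal) < rateJ p I x) :
    ∃ b : Subsets n → ℚ × ℚ, x ∈ ratBox b ∧ ∀ᵐ ω ∂P, ∀ᶠ N : ℕ in atTop,
      empiricalMeasure N (k N) (fun s τ => ξ N s τ ω) (ratBox b) ≤
        ENNReal.ofReal (Real.exp (-(N * r))) := by
  -- Only the sides in `T` need a bound; `T` is everything on the support, and the subsets of a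
  -- violated `s` off it.
  have key (T : Finset (Subsets n)) (w : Subsets n → ℝ)
      (hw : ∀ t ∈ T, (w t : EReal) < I t (x t)) :
      ∃ b : Subsets n → ℚ × ℚ, x ∈ ratBox b ∧ ∀ t ∈ T, ∀ᶠ N : ℕ in atTop,
        (law t N : Measure ℝ) (Ioo ((b t).1 : ℝ) ((b t).2 : ℝ)) ≤
          ENNReal.ofReal (Real.exp (-(N * w t))) := by
    have h1 (t : Subsets n) : ∃ b : ℚ × ℚ, x t ∈ Ioo (b.1 : ℝ) (b.2 : ℝ) ∧
        (t ∈ T → ∀ᶠ N : ℕ in atTop, (law t N : Measure ℝ) (Ioo (b.1 : ℝ) (b.2 : ℝ)) ≤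
          ENNReal.ofReal (Real.exp (-(N * w t)))) := by
      by_cases ht : t ∈ T
      · obtain ⟨U, hU, hle⟩ := exists_nhds_eventually_le (hLDP t) (hw t ht)
        obtain ⟨b, hb1, hb2⟩ := exists_rat_Ioo_subset hU
        exact ⟨b, hb1, fun _ => hle.mono fun N hN => (measure_mono hb2).trans hN⟩
      · obtain ⟨b, hb1, -⟩ := exists_rat_Ioo_subset (univ_mem (f := 𝓝 (x t)))
        exact ⟨b, hb1, fun h => absurd h ht⟩
    choose b hb1 hb2 using h1
    exact ⟨b, fun t _ => hb1 t, hb2⟩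
  by_cases hx : x ∈ rateSupport p I
  · rw [rateJ_of_mem hx] at hr
    obtain ⟨w, hw, hrw⟩ := exists_lt_of_lt_sum hr
    obtain ⟨b, hb, hle⟩ := key Finset.univ w hw
    exact ⟨b, hb, ae_eventually_empiricalMeasure_le hk hdis (measurableSet_Ioo_rat b)
      (fun t => hle t (Finset.mem_univ t)) hrw⟩
  · have hx' : ∃ s : Subsets n, ENNReal.ofReal (∑ j ∈ s.1, p j * Real.log 2) <
        ∑ t with t.1 ⊆ s.1, I t (x t) := by
      simpa [rateSupport] using hx
    obtain ⟨s, hs⟩ := hx'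
    have hpos : 0 ≤ ∑ j ∈ s.1, p j * Real.log 2 :=
      Finset.sum_nonneg fun j _ => mul_nonneg (hp j).le (Real.log_nonneg one_le_two)
    rw [← EReal.coe_ennreal_lt_coe_ennreal_iff, EReal.coe_ennreal_ofReal, max_eq_left hpos] at hs
    obtain ⟨w, hw, hrw⟩ := exists_lt_of_lt_sum hs
    obtain ⟨b, hb, hle⟩ := key _ w hw
    refine ⟨b, hb, ?_⟩
    filter_upwards [ae_eventually_notMem_hitEvent hkp hdis (measurableSet_Ioo_rat b) s.1
      (fun t ht => (Finset.mem_filter.1 ht).2) hle hrw] with ω hω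
    filter_upwards [hω] with N hN
    rw [ratBox, empiricalMeasure_pi (measurableSet_Ioo_rat b), Finset.sum_eq_zero fun σ _ => ?_]
    · simp
    · exact indicator_of_notMem (fun hσ => hN σ (hitEvent_anti (Finset.subset_univ _) σ hσ)) _

/-- Scaling by θ < 1 multiplies each cost by at most θ, and the entropies are positive, so all
constraints become strict; the slack leaves room to raise each cost by a common δ > 0. -/
lemma exists_mem_strict_of_rateJ_lt (hp : ∀ j, 0 < p j) (hconv : ∀ s, ConvexOn ℝ≥0 univ (I s))
    (h0 : ∀ s, I s 0 = 0) {x : Subsets n → ℝ} {r : ℝ} (hr : (rateJ p I x : EReal) < r)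
    {G : Set (Subsets n → ℝ)} (hG : G ∈ 𝓝 x) :
    ∃ y ∈ G, ∃ w : Subsets n → ℝ, (∀ t, (I t (y t) : EReal) < w t) ∧
      (∀ s : Subsets n, ∑ t with t.1 ⊆ s.1, w t < ∑ j ∈ s.1, p j * Real.log 2) ∧
      ∑ t, w t < r := by
  have hx : x ∈ rateSupport p I := by
    by_contra hx
    rw [rateJ_of_notMem hx] at hr
    exact not_top_lt hr
  rw [rateJ_of_mem hx] at hr
  have hpos (s : Subsets n) : 0 < ∑ j ∈ s.1, p j * Real.log 2 :=
    Finset.sum_pos (fun j _ => mul_pos (hp j) (Real.log_pos one_lt_two)) s.2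
  have hfin (t : Subsets n) : I t (x t) ≠ ∞ := by
    refine ne_top_of_le_ne_top ENNReal.ofReal_ne_top (le_trans ?_ (hx t))
    exact Finset.single_le_sum (f := fun t => I t (x t)) (fun _ _ => zero_le)
      (Finset.mem_filter.2 ⟨Finset.mem_univ t, subset_rfl⟩)
  set u : Subsets n → ℝ := fun t => (I t (x t)).toReal with hu
  have hu0 (t : Subsets n) : 0 ≤ u t := ENNReal.toReal_nonneg
  have hsupp (s : Subsets n) : ∑ t with t.1 ⊆ s.1, u t ≤ ∑ j ∈ s.1, p j * Real.log 2 := by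
    rw [hu, ← ENNReal.toReal_sum fun t _ => hfin t]
    exact ENNReal.toReal_le_of_le_ofReal (hpos s).le (hx s)
  have hsum : ∑ t, u t < r := by
    have h1 : ((∑ t, I t (x t) : ℝ≥0∞) : EReal) = ((∑ t, u t : ℝ) : EReal) := by
      rw [hu, ← ENNReal.toReal_sum fun t _ => hfin t,
        ← max_eq_left (ENNReal.toReal_nonneg (a := ∑ t, I t (x t))),
        ← EReal.coe_ennreal_ofReal, ENNReal.ofReal_toReal (ENNReal.sum_ne_top.2 fun t _ => hfin t)]
    rw [h1] at hr
    exact_mod_cast hr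
  obtain ⟨θ, hθG, hθ0, hθ1⟩ : ∃ θ : ℝ, (fun t => θ * x t) ∈ G ∧ 0 < θ ∧ θ < 1 := by
    have h1 : Tendsto (fun θ : ℝ => fun t => θ * x t) (𝓝[<] 1) (𝓝 x) := by
      have : Continuous fun θ : ℝ => fun t => θ * x t := by fun_prop
      have h2 := this.tendsto 1
      simp only [one_mul] at h2
      exact h2.mono_left nhdsWithin_le_nhds
    exact ((h1.eventually_mem hG).and ((Ioo_mem_nhdsLT one_pos))).exists
  have hlt (s : Subsets n) : ∑ t with t.1 ⊆ s.1, θ * u t < ∑ j ∈ s.1, p j * Real.log 2 := by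
    rw [← Finset.mul_sum]
    nlinarith [hsupp s, hpos s]
  have hltr : ∑ t, θ * u t < r := by
    rw [← Finset.mul_sum]
    nlinarith [Finset.sum_nonneg fun t (_ : t ∈ Finset.univ) => hu0 t]
  have htend (T : Finset (Subsets n)) : Tendsto (fun δ : ℝ => ∑ t ∈ T, (θ * u t + δ)) (𝓝[>] 0)
      (𝓝 (∑ t ∈ T, θ * u t)) := by
    have : Continuous fun δ : ℝ => ∑ t ∈ T, (θ * u t + δ) := by fun_prop
    have h2 := this.tendsto 0
    simp only [add_zero] at h2
    exact h2.mono_left nhdsWithin_le_nhds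
  obtain ⟨δ, ⟨h1, h2⟩, h3⟩ := (((eventually_all.2 fun s : Subsets n =>
    (htend (Finset.univ.filter fun t => t.1 ⊆ s.1)).eventually_lt_const (hlt s)).and
    ((htend Finset.univ).eventually_lt_const hltr)).and self_mem_nhdsWithin).exists
  refine ⟨_, hθG, fun t => θ * u t + δ, fun t => ?_, h1, h2⟩
  have h4 : I t (θ * x t) ≤ ENNReal.ofReal (θ * u t) := by
    have := rate_smul_le (hconv t) (h0 t) (θ := θ.toNNReal)
      (Real.toNNReal_le_one.2 hθ1.le) (x t)
    rw [Real.coe_toNNReal _ hθ0.le] at this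
    rwa [ENNReal.ofReal_mul hθ0.le, ENNReal.ofReal_toReal (hfin t)]
  refine (EReal.coe_ennreal_le_coe_ennreal_iff.2 h4).trans_lt ?_
  rw [EReal.coe_ennreal_ofReal, max_eq_left (mul_nonneg hθ0.le (hu0 t)), EReal.coe_lt_coe_iff]
  exact lt_add_of_pos_right _ h3

lemma exists_ratBox_ae_eventually_ge
    (hkp : ∀ j, Tendsto (fun N : ℕ => (k N j : ℝ) / (N : ℝ)) atTop (𝓝 (p j)))
    (hk : ∀ᶠ N in atTop, ∑ j, k N j = N)
    (hdis : ∀ᶠ N in atTop, IsDisorder P (k N) (fun s => law s N) (ξ N))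
    (hp : ∀ j, 0 < p j)
    (hLDP : ∀ s, SatisfiesLDP (fun N => (law s N : Measure ℝ)) (I s))
    (hconv : ∀ s, ConvexOn ℝ≥0 univ (I s)) (h0 : ∀ s, I s 0 = 0)
    {x : Subsets n → ℝ} {r : ℝ} (hr : (rateJ p I x : EReal) < r)
    {G : Set (Subsets n → ℝ)} (hG : IsOpen G) (hx : x ∈ G) :
    ∃ b : Subsets n → ℚ × ℚ, ratBox b ⊆ G ∧ ∀ᵐ ω ∂P, ∀ᶠ N : ℕ in atTop,
      ENNReal.ofReal (Real.exp (-(N * r))) ≤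
        empiricalMeasure N (k N) (fun s τ => ξ N s τ ω) (ratBox b) := by
  obtain ⟨y, hy, w, hw, hws, hwr⟩ := exists_mem_strict_of_rateJ_lt hp hconv h0 hr (hG.mem_nhds hx)
  obtain ⟨b, hb, hbG⟩ := exists_ratBox_subset (hG.mem_nhds hy)
  exact ⟨b, hbG, ae_eventually_le_empiricalMeasure hkp hk hdis (measurableSet_Ioo_rat b)
    (fun t => (hLDP t).eventually_ge isOpen_Ioo (hb t (mem_univ t)) (hw t)) hws hwr⟩

lemma ae_satisfiesWeakLDP
    (hkp : ∀ j, Tendsto (fun N : ℕ => (k N j : ℝ) / (N : ℝ)) atTop (𝓝 (p j)))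
    (hk : ∀ᶠ N in atTop, ∑ j, k N j = N)
    (hdis : ∀ᶠ N in atTop, IsDisorder P (k N) (fun s => law s N) (ξ N))
    (hp : ∀ j, 0 < p j)
    (hLDP : ∀ s, SatisfiesLDP (fun N => (law s N : Measure ℝ)) (I s))
    (hconv : ∀ s, ConvexOn ℝ≥0 univ (I s)) (h0 : ∀ s, I s 0 = 0) :
    ∀ᵐ ω ∂P, SatisfiesWeakLDP
      (fun N => empiricalMeasure N (k N) (fun s τ => ξ N s τ ω)) (rateJ p I) := by
  -- Over the countable set of boxes and rational rates, one null set serves all statements that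
  -- hold almost surely. Hence `x` and `r` may be chosen after ω.
  have hcount (E : (Subsets n → ℚ × ℚ) × ℚ → Ω → Prop) :
      ∀ᵐ ω ∂P, ∀ c, (∀ᵐ ω' ∂P, E c ω') → E c ω := by
    refine ae_all_iff.2 fun c => ?_
    by_cases hc : ∀ᵐ ω' ∂P, E c ω'
    · exact hc.mono fun ω hω _ => hω
    · exact Eventually.of_forall fun ω h => absurd h hc
  filter_upwards [hcount fun c ω => ∀ᶠ N : ℕ in atTop,
      empiricalMeasure N (k N) (fun s τ => ξ N s τ ω) (ratBox c.1) ≤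
        ENNReal.ofReal (Real.exp (-(N * (c.2 : ℝ)))),
    hcount fun c ω => ∀ᶠ N : ℕ in atTop, ENNReal.ofReal (Real.exp (-(N * (c.2 : ℝ)))) ≤
      empiricalMeasure N (k N) (fun s τ => ξ N s τ ω) (ratBox c.1)] with ω hup hlow
  refine ⟨isRateFunction_rateJ fun s => (hLDP s).rate, fun G hG => ?_, fun K hK => ?_⟩
  · refine neg_infRate_le_liminf_of_local fun x hx r hr => ?_
    obtain ⟨q, hq1, hq2⟩ := EReal.exists_rat_btwn_of_lt hr
    obtain ⟨b, hbG, hb⟩ := exists_ratBox_ae_eventually_ge hkp hk hdis hp hLDP hconv h0 hq1 hG hx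
    filter_upwards [hlow (b, q) hb] with N hN
    refine le_trans (ENNReal.ofReal_le_ofReal (Real.exp_le_exp.2 ?_)) (hN.trans (measure_mono hbG))
    have hqr : (q : ℝ) < r := EReal.coe_lt_coe_iff.1 hq2
    have : (0 : ℝ) ≤ N := Nat.cast_nonneg N
    exact neg_le_neg (mul_le_mul_of_nonneg_left hqr.le this)
  · refine limsup_le_neg_infRate_of_local hK fun x r hr => ?_
    obtain ⟨q, hq1, hq2⟩ := EReal.exists_rat_btwn_of_lt hr
    obtain ⟨b, hxb, hb⟩ := exists_ratBox_ae_eventually_le hkp hk hdis hp hLDP hq2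
    refine ⟨ratBox b, ratBox_mem_nhds hxb, ?_⟩
    filter_upwards [hup (b, q) hb] with N hN
    refine hN.trans (ENNReal.ofReal_le_ofReal (Real.exp_le_exp.2 ?_))
    have hqr : r < (q : ℝ) := EReal.coe_lt_coe_iff.1 hq1
    have : (0 : ℝ) ≤ N := Nat.cast_nonneg N
    exact neg_le_neg (mul_le_mul_of_nonneg_left hqr.le this)

lemma ae_eventually_forall_notMem
    (hkp : ∀ j, Tendsto (fun N : ℕ => (k N j : ℝ) / (N : ℝ)) atTop (𝓝 (p j)))
    (hdis : ∀ᶠ N in atTop, IsDisorder P (k N) (fun s => law s N) (ξ N))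
    (hp : ∀ j, 0 < p j) (s : Subsets n)
    (hLDP : SatisfiesLDP (fun N => (law s N : Measure ℝ)) (I s)) {F : Set ℝ} (hF : IsClosed F)
    {c : ℝ≥0∞} (hc : ∀ y ∈ F, c ≤ I s y)
    (hlt : ENNReal.ofReal (∑ j ∈ s.1, p j * Real.log 2) < c) :
    ∀ᵐ ω ∂P, ∀ᶠ N in atTop, ∀ σ : Config (k N), ξ N s (σ.restrict s.1) ω ∉ F := by
  have hpos : 0 ≤ ∑ j ∈ s.1, p j * Real.log 2 :=
    Finset.sum_nonneg fun j _ => mul_nonneg (hp j).le (Real.log_nonneg one_le_two)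
  rw [← EReal.coe_ennreal_lt_coe_ennreal_iff, EReal.coe_ennreal_ofReal, max_eq_left hpos] at hlt
  obtain ⟨w, hw1, hw2⟩ := EReal.lt_iff_exists_real_btwn.1 hlt
  have := ae_eventually_notMem_hitEvent hkp hdis (D := fun _ => F) (fun _ => hF.measurableSet) s.1
    (T := {s}) (w := fun _ => w) (by simp)
    (fun t ht => by
      rw [Finset.mem_singleton.1 ht]
      exact eventually_le_of_forall_le hLDP hF hc hw2)
    (by simpa using hw1)
  filter_upwards [this] with ω hω
  filter_upwards [hω] with N hN σ hσ
  exact hN σ fun t ht => by rwa [Finset.mem_singleton.1 ht]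

/-- The empirical measures satisfy the full principle if every coordinate either leaves the support
of the rate function in a given direction or makes the rate function vanish there. -/
lemma ae_satisfiesLDP_of_bounded_or_zero
    (hkp : ∀ j, Tendsto (fun N : ℕ => (k N j : ℝ) / (N : ℝ)) atTop (𝓝 (p j)))
    (hk : ∀ᶠ N in atTop, ∑ j, k N j = N)
    (hdis : ∀ᶠ N in atTop, IsDisorder P (k N) (fun s => law s N) (ξ N))
    (hp : ∀ j, 0 < p j)
    (hLDP : ∀ s, SatisfiesLDP (fun N => (law s N : Measure ℝ)) (I s))
    (hconv : ∀ s, ConvexOn ℝ≥0 univ (I s)) (h0 : ∀ s, I s 0 = 0)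
    (hright : ∀ s : Subsets n,
      (∃ M, 0 ≤ M ∧ ENNReal.ofReal (∑ j ∈ s.1, p j * Real.log 2) < I s M) ∨
        ∀ x : Subsets n → ℝ, 0 ≤ x s → rateJ p I x = 0)
    (hleft : ∀ s : Subsets n,
      (∃ M, M ≤ 0 ∧ ENNReal.ofReal (∑ j ∈ s.1, p j * Real.log 2) < I s M) ∨
        ∀ x : Subsets n → ℝ, x s ≤ 0 → rateJ p I x = 0) :
    ∀ᵐ ω ∂P, SatisfiesLDP
      (fun N => empiricalMeasure N (k N) (fun s τ => ξ N s τ ω)) (rateJ p I) := by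
  have hR (s : Subsets n) : ∃ M : ℝ, ∀ᵐ ω ∂P, ∀ᶠ N in atTop, ∀ σ : Config (k N),
      ξ N s (σ.restrict s.1) ω ≤ M ∨
        ∀ x : Subsets n → ℝ, x s = ξ N s (σ.restrict s.1) ω → rateJ p I x = 0 := by
    rcases hright s with ⟨M, hM, hlt⟩ | hz
    · refine ⟨M, ?_⟩
      filter_upwards [ae_eventually_forall_notMem hkp hdis hp s (hLDP s) (isClosed_Ici (a := M))
        (fun y hy => rate_mono_of_nonneg (hconv s) (h0 s) hM hy) hlt] with ω hω
      filter_upwards [hω] with N hN σ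
      exact Or.inl (not_le.1 (hN σ)).le
    · refine ⟨0, Eventually.of_forall fun ω => Eventually.of_forall fun N σ => ?_⟩
      exact (le_total _ _).imp_right fun h x hx => hz x (hx ▸ h)
  have hL (s : Subsets n) : ∃ M : ℝ, ∀ᵐ ω ∂P, ∀ᶠ N in atTop, ∀ σ : Config (k N),
      M ≤ ξ N s (σ.restrict s.1) ω ∨
        ∀ x : Subsets n → ℝ, x s = ξ N s (σ.restrict s.1) ω → rateJ p I x = 0 := by
    rcases hleft s with ⟨M, hM, hlt⟩ | hz
    · refine ⟨M, ?_⟩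
      filter_upwards [ae_eventually_forall_notMem hkp hdis hp s (hLDP s) (isClosed_Iic (a := M))
        (fun y hy => rate_anti_of_nonpos (hconv s) (h0 s) hM hy) hlt] with ω hω
      filter_upwards [hω] with N hN σ
      exact Or.inl (not_le.1 (hN σ)).le
    · refine ⟨0, Eventually.of_forall fun ω => Eventually.of_forall fun N σ => ?_⟩
      exact (le_total _ _).imp_right fun h x hx => hz x (hx ▸ h)
  choose b hb using hR
  choose a ha using hL
  filter_upwards [ae_satisfiesWeakLDP hkp hk hdis hp hLDP hconv h0, ae_all_iff.2 hb,
    ae_all_iff.2 ha] with ω hweak hbω haω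
  refine ⟨hweak.rate, hweak.lower, fun F hF => ?_⟩
  -- If the rate function has a zero in `F`, the bound only says that the mass is at most 1.
  -- Otherwise every atom in `F` eventually lies in the fixed compact box `K`, and the weak
  -- principle applies to `F ∩ K`.
  by_cases hz : ∃ x ∈ F, rateJ p I x = 0
  · obtain ⟨x, hxF, hx⟩ := hz
    have h1 : infRate (rateJ p I) F ≤ 0 := (infRate_le hxF).trans (by simp [hx])
    refine le_trans ?_ (show (0 : EReal) ≤ -infRate (rateJ p I) F by
      rw [EReal.le_neg]; simpa using h1)
    have h2 : limsup (logRate (fun N => empiricalMeasure N (k N) (fun s τ => ξ N s τ ω)) F) atTop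
        ≤ -((0 : ℝ) : EReal) := by
      refine limsup_logRate_le ?_
      filter_upwards [hk] with N hN
      refine (measure_mono (subset_univ F)).trans ?_
      rw [empiricalMeasure_univ hN]
      simp
    simpa using h2
  · push Not at hz
    set K : Set (Subsets n → ℝ) := univ.pi fun s => Icc (a s) (b s) with hK
    have hKc : IsCompact K := isCompact_univ_pi fun s => isCompact_Icc
    have hnull : ∀ᶠ N in atTop,
        empiricalMeasure N (k N) (fun s τ => ξ N s τ ω) (F \ K) = 0 := by
      filter_upwards [eventually_all.2 hbω, eventually_all.2 haω] with N hbN haN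
      rw [empiricalMeasure_apply (hF.measurableSet.diff hKc.measurableSet),
        Finset.sum_eq_zero fun σ _ => ?_]
      · simp
      · refine indicator_of_notMem (fun hσ => hσ.2 fun s _ => ?_) _
        have hne := hz _ hσ.1
        exact ⟨(haN s σ).resolve_right fun h => hne (h _ rfl),
          (hbN s σ).resolve_right fun h => hne (h _ rfl)⟩
    have heq : logRate (fun N => empiricalMeasure N (k N) (fun s τ => ξ N s τ ω)) F =ᶠ[atTop]
        logRate (fun N => empiricalMeasure N (k N) (fun s τ => ξ N s τ ω)) (F ∩ K) := by
      filter_upwards [hnull] with N hN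
      simp only [logRate]
      rw [← measure_inter_add_sdiff F hKc.measurableSet, hN, add_zero]
    rw [limsup_congr heq]
    refine (hweak.upper _ (hKc.inter_left hF)).trans (EReal.neg_le_neg_iff.2 ?_)
    unfold infRate
    exact EReal.coe_ennreal_le_coe_ennreal_iff.2 (biInf_mono inter_subset_left)

lemma single_mem_rateSupport (h0 : ∀ s, I s 0 = 0) {s : Subsets n} {y : ℝ} (hy : I s y = 0) :
    (Pi.single s y : Subsets n → ℝ) ∈ rateSupport p I := by
  intro t
  rw [Finset.sum_eq_zero fun u _ => ?_]
  · exact zero_le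
  · rcases eq_or_ne u s with rfl | hne
    · simpa using hy
    · simp [hne, h0]

lemma rateJ_eq_zero_of_subsingleton [Subsingleton (Subsets n)] {s : Subsets n}
    {x : Subsets n → ℝ} (hx : I s (x s) = 0) : rateJ p I x = 0 := by
  have h1 (t : Subsets n) : I t (x t) = 0 := by rwa [Subsingleton.elim t s]
  rw [rateJ_of_mem fun t => by simp [h1]]
  simp [h1]

lemma exists_lt_or_forall_eq_zero {f : ℝ → ℝ≥0∞} (hf : ConvexOn ℝ≥0 univ f) (h0 : f 0 = 0)
    {C : ℝ≥0∞} (hC : C ≠ ∞) :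
    ((∃ M, 0 ≤ M ∧ C < f M) ∨ ∀ x, 0 ≤ x → f x = 0) ∧
      ((∃ M, M ≤ 0 ∧ C < f M) ∨ ∀ x, x ≤ 0 → f x = 0) := by
  refine ⟨or_iff_not_imp_left.2 fun h x hx => ?_, or_iff_not_imp_left.2 fun h x hx => ?_⟩ <;>
    push Not at h <;> refine rate_eq_zero_of_bounded hf h0 hC fun m => h _ ?_
  · positivity
  · exact mul_nonpos_of_nonneg_of_nonpos (by positivity) hx

/-- If I_s vanished on a half-line, the points with that single nonzero coordinate would all lie in
the support, making it unbounded. -/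
lemma exists_lt_of_isCompact_rateSupport (hcomp : IsCompact (rateSupport p I))
    (hconv : ∀ s, ConvexOn ℝ≥0 univ (I s)) (h0 : ∀ s, I s 0 = 0) (s : Subsets n)
    {C : ℝ≥0∞} (hC : C ≠ ∞) :
    (∃ M, 0 ≤ M ∧ C < I s M) ∧ ∃ M, M ≤ 0 ∧ C < I s M := by
  have himg := hcomp.image (continuous_apply s)
  have h1 := exists_lt_or_forall_eq_zero (hconv s) (h0 s) hC
  refine ⟨h1.1.resolve_right fun h => ?_, h1.2.resolve_right fun h => ?_⟩
  · obtain ⟨B, hB⟩ := himg.bddAbove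
    have := hB ⟨Pi.single s (|B| + 1), single_mem_rateSupport h0 (h _ (by positivity)), rfl⟩
    simp only [Pi.single_eq_same] at this
    linarith [le_abs_self B]
  · obtain ⟨B, hB⟩ := himg.bddBelow
    have := hB ⟨Pi.single s (-(|B| + 1)),
      single_mem_rateSupport h0 (h _ (neg_nonpos.2 (by positivity))), rfl⟩
    simp only [Pi.single_eq_same] at this
    linarith [neg_abs_le B]

end BKM

/-! ### The theorem -/

theorem theorem4p1 {Ω : Type*} [MeasurableSpace Ω] (P : Measure Ω) [IsProbabilityMeasure P]
    (n : ℕ) (hn : 1 ≤ n)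
    (k : ℕ → Fin n → ℕ) (hk : ∀ N, n ≤ N → ∑ j, k N j = N)
    (p : Fin n → ℝ) (hp : ∀ j, 0 < p j)
    (hkp : ∀ j, Tendsto (fun N : ℕ => (k N j : ℝ) / (N : ℝ)) atTop (𝓝 (p j)))
    (law : BKM.Subsets n → ℕ → ProbabilityMeasure ℝ)
    (I : BKM.Subsets n → ℝ → ℝ≥0∞)
    (hlaw : ∀ s, Tendsto (law s) atTop (𝓝 (diracProba (0 : ℝ))))
    (hLDP : ∀ s, BKM.SatisfiesLDP (fun N => (law s N : Measure ℝ)) (I s))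
    (hconv : ∀ s, ConvexOn ℝ≥0 Set.univ (I s))
    (ξ : (N : ℕ) → (s : BKM.Subsets n) → BKM.SubConfig (k N) s.1 → Ω → ℝ)
    (hξm : ∀ N, n ≤ N → ∀ s τ, Measurable (ξ N s τ))
    (hξlaw : ∀ N, n ≤ N → ∀ s τ, P.map (ξ N s τ) = (law s N : Measure ℝ))
    (hξind : ∀ N, n ≤ N →
      iIndepFun (fun (a : (s : BKM.Subsets n) × BKM.SubConfig (k N) s.1) => ξ N a.1 a.2) P) :
    (∀ᵐ ω ∂P, BKM.SatisfiesWeakLDP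
      (fun N => BKM.empiricalMeasure N (k N) (fun s τ => ξ N s τ ω)) (BKM.rateJ p I)) ∧
    ((n = 1 ∨ IsCompact (BKM.rateSupport p I)) →
      ∀ᵐ ω ∂P, BKM.SatisfiesLDP
        (fun N => BKM.empiricalMeasure N (k N) (fun s τ => ξ N s τ ω)) (BKM.rateJ p I)) := by
  have h0 (s : BKM.Subsets n) : I s 0 = 0 := BKM.rate_zero_eq_zero (hLDP s) (hlaw s)
  have hk' : ∀ᶠ N in atTop, ∑ j, k N j = N := (eventually_ge_atTop n).mono hk
  have hdis : ∀ᶠ N in atTop, BKM.IsDisorder P (k N) (fun s => law s N) (ξ N) :=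
    (eventually_ge_atTop n).mono fun N hN => ⟨hξm N hN, hξlaw N hN, hξind N hN⟩
  refine ⟨BKM.ae_satisfiesWeakLDP hkp hk' hdis hp hLDP hconv h0, fun hcase => ?_⟩
  refine BKM.ae_satisfiesLDP_of_bounded_or_zero hkp hk' hdis hp hLDP hconv h0
    (fun s => ?_) (fun s => ?_)
  all_goals
    have hC : ENNReal.ofReal (∑ j ∈ s.1, p j * Real.log 2) ≠ ∞ := ENNReal.ofReal_ne_top
    rcases hcase with rfl | hcomp
  -- For n = 1 there is only one coordinate, so the rate function vanishes wherever that one cost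
  -- does.
  · have : Subsingleton (BKM.Subsets 1) := ⟨fun s t => Subtype.ext
      (by rw [s.2.eq_univ, t.2.eq_univ])⟩
    exact (BKM.exists_lt_or_forall_eq_zero (hconv s) (h0 s) hC).1.imp_right
      fun h x hx => BKM.rateJ_eq_zero_of_subsingleton (h _ hx)
  · exact Or.inl (BKM.exists_lt_of_isCompact_rateSupport hcomp hconv h0 s hC).1
  · have : Subsingleton (BKM.Subsets 1) := ⟨fun s t => Subtype.ext
      (by rw [s.2.eq_univ, t.2.eq_univ])⟩
    exact (BKM.exists_lt_or_forall_eq_zero (hconv s) (h0 s) hC).2.imp_right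
      fun h x hx => BKM.rateJ_eq_zero_of_subsingleton (h _ hx)
  · exact Or.inl (BKM.exists_lt_of_isCompact_rateSupport hcomp hconv h0 s hC).2
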